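/- **Permutations.** For $n\ge 1$ let $\mathcal R_n$ be the set of permutations $\pi=\pi_1\cdots\pi_n$ of $\{1,\dots,n\}$ such that there are no $i<j<k$ with $\pi_k<\pi_i<\pi_j$, $j=i+1$ and $\pi_i=\pi_k+1$. For a permutation $\tau$ of $\{1,\dots,m\}$, a site of $\tau$ (the place before its first entry, between two consecutive entries, or after its last entry) is *active* if inserting $m+1$ there gives an element of $\mathcal R_{m+1}$. The active sites are labelled $0,1,2,\dots$ from left to right. Deleting $n$ from $\pi\in\mathcal R_n$ gives an element of $\mathcal R_{n-1}$. Define $\Lambda$ on $\mathcal R_n$ by $\Lambda(1)=(0)$ and, for $n\ge2$, $\Lambda(\pi)=(x_1,\dots,x_{n-1},i)$ if $\pi$ is obtained by inserting $n$ in the active site labelled $i$ of $\tau\in\mathcal R_{n-1}$ and $\Lambda(\tau)=(x_1,\dots,x_{n-1})$. It is a bijection from $\mathcal R_n$ to the set of ascent sequences of length $n$, that is, sequences $(x_1,\dots,x_n)$ of nonnegative integers with $x_1=0$ and $x_i\le 1+|\{1\le j<i-1: x_j<x_{j+1}\}|$ for $2\le i\le n$. **Posets.** A poset is $(\mathbf{2+2})$-free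 if it has no induced subposet isomorphic to the disjoint union of two 2-element chains. For a finite nonempty $(\mathbf{2+2})$-free poset $P$ put $D(x)=\{y: y<x\}$. The sets $D(x)$ form a chain $\emptyset=D_0\subset D_1\subset\dots\subset D_k$; put $\mathrm{rank}(P)=k$ and $L_i(P)=\{x\in P: D(x)=D_i\}$, the set of elements at level $i$. Let $i$ be the minimum level of $P$ containing a maximal element. If $|P|\ge 2$, the *removal operation* removes a maximal element at level $i$; if moreover $|L_i(P)|=1$ and $i<k$, it also deletes all relations $x<y$ with $x\in D_{i+1}\setminus D_i$. The result is a $(\mathbf{2+2})$-free poset $Q$, which up to isomorphism does not depend on the choice of the removed element. Define $\Psi(P)=(0)$ if $|P|=1$, and otherwise $\Psi(P)=(x_1,\dots,x_{n-1},i)$ where $n=|P|$ and $(x_1,\dots,x_{n-1})=\Psi(Q)$. A *canonical labelling* of $P$ by $1,\dots,n$ is obtained by applying the removal operation repeatedly: the first element removed gets label $n$, the next one $n-1$, and so on; the last remaining element gets label $1$. **Proposition.** Let $P$ be a finite nonempty $(\mathbf{2+2})$-free poset with $n$ elements. Then $P$ has a canonical labelling. For every canonical labelling of $P$, let $\widehat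 L_j$ be the word obtained by reading the labels of the elements of $L_j(P)$ in decreasing order, and let $\pi=\widehat L_0\widehat L_1\cdots\widehat L_{\mathrm{rank}(P)}$. Then $\pi\in\mathcal R_n$, $\Psi(P)$ is an ascent sequence of length $n$, and $$\Lambda^{-1}(\Psi(P))=\pi,$$ that is, $\pi$ is the unique element of $\mathcal R_n$ with $\Lambda(\pi)=\Psi(P)$. Moreover, the active sites of $\pi$ are exactly the site before its first entry, the site after its last entry, and the sites separating two consecutive factors $\widehat L_{j-1}$ and $\widehat L_j$, $1\le j\le \mathrm{rank}(P)$. -/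

import Mathlib

/-! ## Ascent sequences -/

/-- The number of ascents of a sequence: the number of (0-based) `j` with `j + 1 < x.length`
and `x j < x (j + 1)`. -/
def ascCount (x : List ℕ) : ℕ :=
  ((Finset.range (x.length - 1)).filter (fun j => x.getD j 0 < x.getD (j + 1) 0)).card

/-- The ascent sequences of length `n`: the first entry is `0`, and each later entry is at most
one more than the number of ascents of the prefix before it. -/
def ascentSeqs (n : ℕ) : Set (List ℕ) :=
  {x | x.length = n ∧ (∀ h : 0 < x.length, x[0] = 0) ∧
    ∀ (i : ℕ) (hi : i < x.length), 0 < i → x[i] ≤ 1 + ascCount (x.take i)}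

/-! ## The pattern-avoiding permutations, their active sites, and the map to sequences -/

/-- The permutations of `{1, …, n}`, written as words, in which no subword `π i, π j, π k`
(`i < j < k`) that is order-isomorphic to `231` has `j = i + 1` and `π i = π k + 1`. -/
def permsR (n : ℕ) : Set (List ℕ) :=
  {π | π.Perm (List.range' 1 n) ∧
    ∀ (i j k : ℕ) (hij : i < j) (hjk : j < k) (hk : k < π.length),
      π[k] < π[i] → π[i] < π[j] → j ≠ i + 1 ∨ π[i] ≠ π[k] + 1}

open Classical in
/-- The active sites of a permutation `τ` of `{1, …, m}`. Site `s` (`0 ≤ s ≤ m`) is the place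
with exactly `s` entries to its left; it is active if inserting `m + 1` there gives an element of
`permsR (m + 1)`. -/
noncomputable def activeSites (τ : List ℕ) : Finset ℕ :=
  (Finset.range (τ.length + 1)).filter
    (fun s => τ.insertIdx s (τ.length + 1) ∈ permsR (τ.length + 1))

/-- The label of a site `s` of `τ`: active sites are labelled `0, 1, 2, …` from left to right. -/
noncomputable def siteLabel (τ : List ℕ) (s : ℕ) : ℕ :=
  ((activeSites τ).filter (fun t => t < s)).card

/-- The map `Λ` on words that are permutations of `{1, …, n}`. If `π` is obtained from `τ` by
inserting the maximal entry at a site labelled `i`, then `Λ π` is `Λ τ` followed by `i`. -/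
noncomputable def Lam : ℕ → List ℕ → List ℕ
  | 0, _ => []
  | 1, _ => [0]
  | n + 2, π =>
    Lam (n + 1) (π.erase (n + 2)) ++ [siteLabel (π.erase (n + 2)) (π.idxOf (n + 2))]

/-! ## Finite posets -/

/-- A poset has no induced subposet isomorphic to `2 + 2`, the disjoint union of two
two-element chains (the order on `Fin 2 ⊕ Fin 2` has no relation between the two summands). -/
def IsTwoPlusTwoFree (P : Type*) [PartialOrder P] : Prop :=
  IsEmpty ((Fin 2 ⊕ Fin 2) ↪o P)

/-- A finite poset whose elements are taken from an ambient type `α`, given by its strict order.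
Only the restriction of `lt` to `carrier` matters. -/
structure FinPoset (α : Type*) where
  carrier : Finset α
  lt : α → α → Prop
  irrefl : ∀ x, ¬ lt x x
  trans : ∀ x y z, lt x y → lt y z → lt x z

namespace FinPoset

/-- A finite partially ordered type as a `FinPoset`. -/
def of (P : Type*) [Fintype P] [PartialOrder P] : FinPoset P where
  carrier := Finset.univ
  lt := fun x y => x < y
  irrefl := fun x => lt_irrefl x
  trans := fun _ _ _ h₁ h₂ => lt_trans h₁ h₂

variable {α : Type*} (P : FinPoset α)

open Classical in
/-- The set `D(x)` of predecessors of `x`. -/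
noncomputable def pred (x : α) : Finset α :=
  P.carrier.filter (fun y => P.lt y x)

open Classical in
/-- The set `D(P) = {D(x) : x ∈ P}` of all predecessor sets. -/
noncomputable def predSets : Finset (Finset α) :=
  P.carrier.image P.pred

/-- The rank `k` of `P`, where `D(P) = {D_0 ⊂ D_1 ⊂ ⋯ ⊂ D_k}`. -/
noncomputable def rank : ℕ := P.predSets.card - 1

open Classical in
/-- The level of `x`: the index `i` with `D(x) = D_i`, where `D_0 ⊂ ⋯ ⊂ D_k` are the predecessor
sets (for a `(2+2)`-free poset they form a chain). Equivalently, the number of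
predecessor sets that are properly contained in `D(x)`. -/
noncomputable def level (x : α) : ℕ :=
  (P.predSets.filter (fun D => D ⊂ P.pred x)).card

open Classical in
/-- The set `L_i(P)` of elements at level `i`. -/
noncomputable def levelSet (i : ℕ) : Finset α :=
  P.carrier.filter (fun x => P.level x = i)

open Classical in
/-- The predecessor set `D_i(P)` of the elements at level `i`. -/
noncomputable def predAt (i : ℕ) : Finset α :=
  P.carrier.filter (fun y => ∃ x ∈ P.levelSet i, P.lt y x)

/-- `x` is a maximal element of `P`. -/
def IsMaxElt (x : α) : Prop :=
  x ∈ P.carrier ∧ ∀ y ∈ P.carrier, ¬ P.lt x y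

/-- The minimum level containing a maximal element. -/
noncomputable def srank : ℕ :=
  sInf {i | ∃ x, P.IsMaxElt x ∧ P.level x = i}

/-- `x` is one of the elements that the removal operation may remove: a maximal element at the
minimum level containing a maximal element. -/
def Removable (x : α) : Prop :=
  P.IsMaxElt x ∧ P.level x = P.srank

open Classical in
/-- The poset obtained by removing `x`, an element at level `i`. If `x` is alone at its level and
`i` is less than the rank, then all relations `y < z` with `y ∈ D_{i+1} \ D_i` are deleted as
well. In the other cases the order relation is left as it is. -/
noncomputable def remove (x : α) : FinPoset α where
  carrier := P.carrier.erase x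
  lt := fun y z => P.lt y z ∧
    ¬ ((P.levelSet (P.level x)).card = 1 ∧ P.level x < P.rank ∧
        y ∈ P.predAt (P.level x + 1) \ P.predAt (P.level x))
  irrefl := fun y h => P.irrefl y h.1
  trans := fun y z w h₁ h₂ => ⟨P.trans y z w h₁.1 h₂.1, h₁.2⟩

open Classical in
/-- The map `Ψ` on posets with `n` elements. If the removal operation turns `P` into `Q` by
removing an element at level `i`, then `Ψ P` is `Ψ Q` followed by `i`. (A removable element
always exists when the poset is nonempty, and the choice of it is immaterial up to isomorphism
in a `(2+2)`-free poset.) -/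
noncomputable def Psi : ℕ → FinPoset α → List ℕ
  | 0, _ => []
  | 1, _ => [0]
  | n + 2, P =>
    if h : ∃ x, P.Removable x then Psi (n + 1) (P.remove h.choose) ++ [P.srank] else []

/-- `ℓ` is a canonical labelling of `P` by `1, …, n`, where `n` is the number of elements: it
comes from performing the removal operation repeatedly, where the first element that is removed
gets label `n`, the next one `n - 1`, and so on; the last remaining element gets label `1`. -/
inductive IsCanonicalLabelling (ℓ : α → ℕ) : FinPoset α → Prop
  | single (P : FinPoset α) (x : α) (hP : P.carrier = {x}) (hx : ℓ x = 1) :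
      IsCanonicalLabelling ℓ P
  | step (P : FinPoset α) (x : α) (hcard : 2 ≤ P.carrier.card) (hrem : P.Removable x)
      (hx : ℓ x = P.carrier.card) (hQ : IsCanonicalLabelling ℓ (P.remove x)) :
      IsCanonicalLabelling ℓ P

/-- The word obtained by reading the labels of the elements at level `j` in decreasing order. -/
noncomputable def levelWord (ℓ : α → ℕ) (j : ℕ) : List ℕ :=
  ((P.levelSet j).image ℓ).sort (fun a b => b ≤ a)

/-- The concatenation of the words of the first `m` levels, i.e. of the levels `0, …, m - 1`. -/
noncomputable def prefixWord (ℓ : α → ℕ) (m : ℕ) : List ℕ :=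
  (List.range m).flatMap (P.levelWord ℓ)

/-- The word obtained by reading all the levels `0, …, rank P` one after the other. -/
noncomputable def word (ℓ : α → ℕ) : List ℕ :=
  P.prefixWord ℓ (P.rank + 1)

end FinPoset

/-! Reading labels level by level turns the removal operation on posets into the deletion of the
largest entry of a permutation, and the level of the removed element becomes the label of the active
site. The whole proof is an induction along this correspondence.

On the poset side, (2+2)-freeness enters only through the fact that the predecessor sets form a
chain (`isNested_of`), which removal preserves. If removing `x` at level `i` turns `P` into `Q`, the
word of `P` is the word of `Q` with the new largest label inserted at the block boundary numbered
`i` (`prefixWord_remove`). If `x` was alone at its level, the new label is a block of its own and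
one boundary is gained. Otherwise it heads the existing block `i` and the number of boundaries is
unchanged.

On the permutation side, inserting `m + 1` at an active site `s` leaves the status of every old site
as it was, up to a shift. The only new question is the site just after `m + 1`, which is active iff
`m` stands to the left of `s`.

The two pictures agree because `m` labels an element removable from `Q`: it stands left of `s` iff
the minimum level of a maximal element drops below `i`, and by `srank_remove_lt_iff` this happens
iff `x` was alone at its level. Hence the active sites are always the block boundaries, boundary `i`
carries label `i`, and the word has image `Ψ P` (`WordSpec.of_remove`).

Uniqueness is the injectivity of `Λ`. That its values are ascent sequences follows by counting:
there are always two more active sites than ascents. -/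

/-! ### Pattern avoidance and insertion of a largest entry -/

/-- A word with no consecutive `a, b` followed later by `c`, where `a < b` and `a = c + 1`. -/
def AvoidsR : List ℕ → Prop
  | [] => True
  | [_] => True
  | a :: b :: l => (a < b → ∀ c ∈ l, a ≠ c + 1) ∧ AvoidsR (b :: l)

/-- The entry just before site `s` does not exceed by one an entry after site `s`. -/
def OpenSite (τ : List ℕ) (s : ℕ) : Prop :=
  ∀ u ∈ (τ.take s).getLast?, ∀ c ∈ τ.drop s, u ≠ c + 1

theorem avoidsR_iff_getElem (l : List ℕ) :
    AvoidsR l ↔ ∀ (i k : ℕ) (hik : i + 1 < k) (hk : k < l.length),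
      l[i] < l[i + 1] → l[i] ≠ l[k] + 1 := by
  induction l with
  | nil => simp [AvoidsR]
  | cons a l ih =>
    cases l with
    | nil =>
      simp only [AvoidsR, true_iff]
      intro i k hik hk
      simp at hk
      omega
    | cons b l =>
      rw [AvoidsR, ih]
      constructor
      · rintro ⟨h1, h2⟩ i k hik hk hlt
        obtain ⟨k, rfl⟩ : ∃ k', k = k' + 2 := ⟨k - 2, by omega⟩
        cases i with
        | zero =>
          simp only [List.length_cons] at hk
          have hk' : k < l.length := by omega
          exact h1 (by simpa using hlt) l[k] (List.getElem_mem hk')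
        | succ i =>
          exact h2 i (k + 1) (by omega) (by simp at hk ⊢; omega) (by simpa using hlt)
      · intro h
        constructor
        · intro hab c hc
          obtain ⟨k, hk, rfl⟩ := List.getElem_of_mem hc
          exact h 0 (k + 2) (by omega) (by simp; omega) (by simpa using hab)
        · intro i k hik hk hlt
          exact h (i + 1) (k + 1) (by omega) (by simp at hk ⊢; omega) (by simpa using hlt)

/-- The equation `π i = π k + 1` already forces `π k < π i`, so only the ascent at `i` remains as an
inequality. The recursive form suits induction on the word. -/
theorem mem_permsR_iff {n : ℕ} {l : List ℕ} :
    l ∈ permsR n ↔ l.Perm (List.range' 1 n) ∧ AvoidsR l := by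
  rw [avoidsR_iff_getElem]
  constructor
  · rintro ⟨h1, h2⟩
    refine ⟨h1, fun i k hik hk hlt heq => ?_⟩
    rcases h2 i (i + 1) k (by omega) hik hk (by omega) hlt with h | h
    · exact h rfl
    · exact h heq
  · rintro ⟨h1, h2⟩
    refine ⟨h1, fun i j k hij hjk hk h3 h4 => ?_⟩
    by_cases hj : j = i + 1
    · subst hj
      exact Or.inr (h2 i k hjk hk h4)
    · exact Or.inl hj

theorem avoidsR_cons_of_forall_lt {n : ℕ} {V : List ℕ} (h : ∀ v ∈ V, v < n) :
    AvoidsR (n :: V) ↔ AvoidsR V := by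
  cases V with
  | nil => simp [AvoidsR]
  | cons v V =>
    have := h v (by simp)
    simp [AvoidsR, this.not_gt]

/-- A largest entry can only be the middle of a forbidden pattern, and then the first letter is the
last entry of `U`. Conversely, the insertion separates that entry from the head of `V`, but a
pattern destroyed in this way would already violate the second condition. -/
theorem avoidsR_insert {n : ℕ} {U V : List ℕ} (hU : ∀ u ∈ U, u < n) (hV : ∀ v ∈ V, v < n) :
    AvoidsR (U ++ n :: V) ↔ AvoidsR (U ++ V) ∧ ∀ u ∈ U.getLast?, ∀ c ∈ V, u ≠ c + 1 := by
  induction U with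
  | nil => simp [avoidsR_cons_of_forall_lt hV]
  | cons u U ih =>
    have hu : u < n := hU u (by simp)
    cases U with
    | nil =>
      have h1 : AvoidsR (u :: n :: V) ↔ (∀ c ∈ V, u ≠ c + 1) ∧ AvoidsR V := by
        rw [AvoidsR, avoidsR_cons_of_forall_lt hV]
        simp [hu]
      have h2 : (∀ c ∈ V, u ≠ c + 1) → (AvoidsR (u :: V) ↔ AvoidsR V) := by
        intro h
        cases V with
        | nil => simp [AvoidsR]
        | cons v V =>
          rw [AvoidsR, and_iff_right]
          exact fun _ c hc => h c (by simp [hc])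
      simp only [List.singleton_append, h1, List.getLast?_singleton, Option.mem_some_iff,
        forall_eq']
      tauto
    | cons u' U =>
      have ih := ih (fun x hx => hU x (by simp [hx]))
      simp only [List.cons_append] at ih ⊢
      rw [AvoidsR, AvoidsR, ih, List.getLast?_cons_cons]
      have : (∀ c ∈ U ++ n :: V, u ≠ c + 1) ↔ ∀ c ∈ U ++ V, u ≠ c + 1 := by
        constructor
        · intro h c hc
          refine h c ?_
          simp at hc ⊢
          tauto
        · intro h c hc
          by_cases hcn : c = n
          · omega
          · refine h c ?_
            simp at hc ⊢
            tauto
      rw [this, and_assoc]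

theorem length_of_mem_permsR {n : ℕ} {l : List ℕ} (h : l ∈ permsR n) : l.length = n := by
  simpa using h.1.length_eq

theorem mem_iff_of_mem_permsR {n a : ℕ} {l : List ℕ} (h : l ∈ permsR n) :
    a ∈ l ↔ 1 ≤ a ∧ a ≤ n := by
  rw [h.1.mem_iff, List.mem_range'_1]
  omega

theorem nodup_of_mem_permsR {n : ℕ} {l : List ℕ} (h : l ∈ permsR n) : l.Nodup :=
  h.1.nodup_iff.2 List.nodup_range'

theorem insertIdx_eq_take_append_drop {l : List ℕ} {s : ℕ} (hs : s ≤ l.length) (a : ℕ) :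
    l.insertIdx s a = l.take s ++ a :: l.drop s := by
  induction l generalizing s with
  | nil =>
    obtain rfl : s = 0 := by simpa using hs
    simp
  | cons b l ih =>
    cases s with
    | zero => simp
    | succ s => simp [ih (by simpa using hs)]

/-- Avoidance by `τ` is a conclusion here, not an assumption, so the same equivalence describes
active sites and shows that deleting the largest entry stays in the class. -/
theorem insertIdx_mem_permsR_iff {m s : ℕ} {τ : List ℕ} (h : τ.Perm (List.range' 1 m))
    (hs : s ≤ m) :
    τ.insertIdx s (m + 1) ∈ permsR (m + 1) ↔ AvoidsR τ ∧ OpenSite τ s := by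
  have hlen : τ.length = m := by simpa using h.length_eq
  have hlt : ∀ a ∈ τ, a < m + 1 := fun a ha => by
    have := List.mem_range'_1.1 (h.mem_iff.1 ha)
    omega
  rw [mem_permsR_iff, insertIdx_eq_take_append_drop (by omega),
    avoidsR_insert (fun u hu => hlt u (List.mem_of_mem_take hu))
      (fun u hu => hlt u (List.mem_of_mem_drop hu)), List.take_append_drop, and_iff_right]
  · rfl
  · refine List.perm_middle.trans ?_
    rw [List.take_append_drop]
    refine (h.cons (m + 1)).trans ?_
    rw [List.range'_concat]
    simpa [add_comm] using (List.perm_append_singleton (m + 1) (List.range' 1 m)).symm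

theorem mem_activeSites_iff {m s : ℕ} {τ : List ℕ} (h : τ ∈ permsR m) :
    s ∈ activeSites τ ↔ s ≤ m ∧ OpenSite τ s := by
  have hlen := length_of_mem_permsR h
  classical
  rw [activeSites, Finset.mem_filter, Finset.mem_range, hlen, Nat.lt_succ_iff]
  refine and_congr_right fun hs => ?_
  rw [insertIdx_mem_permsR_iff h.1 hs, and_iff_right (mem_permsR_iff.1 h).2]

/-- Every element of `permsR (m + 1)` arises by inserting `m + 1` at an active site. -/
theorem erase_max_mem_permsR {m : ℕ} {π : List ℕ} (h : π ∈ permsR (m + 1)) :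
    π.erase (m + 1) ∈ permsR m ∧ π.idxOf (m + 1) ∈ activeSites (π.erase (m + 1)) ∧
      (π.erase (m + 1)).insertIdx (π.idxOf (m + 1)) (m + 1) = π := by
  have hmem : m + 1 ∈ π := (mem_iff_of_mem_permsR h).2 (by omega)
  have hlen := length_of_mem_permsR h
  have hidx' : π.idxOf (m + 1) < π.length := List.idxOf_lt_length_iff.2 hmem
  have hidx : π.idxOf (m + 1) < m + 1 := hidx'.trans_eq hlen
  have hperm : (π.erase (m + 1)).Perm (List.range' 1 m) := by
    have h1 := h.1.erase (m + 1)
    rw [List.range'_concat] at h1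
    refine h1.trans ?_
    rw [List.erase_append_right]
    · simp [add_comm]
    · simp [List.mem_range'_1, add_comm]
  have hins : (π.erase (m + 1)).insertIdx (π.idxOf (m + 1)) (m + 1) = π := by
    rw [List.erase_eq_eraseIdx_of_idxOf (i := π.idxOf (m + 1)) rfl]
    have hx : π[π.idxOf (m + 1)]'hidx' = m + 1 := List.getElem_idxOf _
    have := List.insertIdx_eraseIdx_getElem hidx'
    rwa [hx] at this
  have hkey := (insertIdx_mem_permsR_iff hperm (by omega : π.idxOf (m + 1) ≤ m)).1
    (by rw [hins]; exact h)
  have hR : π.erase (m + 1) ∈ permsR m := mem_permsR_iff.2 ⟨hperm, hkey.1⟩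
  exact ⟨hR, (mem_activeSites_iff hR).2 ⟨by omega, hkey.2⟩, hins⟩

/-! ### Active sites after an insertion -/

section Insert

variable {m s : ℕ} {τ : List ℕ} (h : τ ∈ permsR m) (hs : s ∈ activeSites τ)
include h hs

theorem insert_mem_permsR : τ.insertIdx s (m + 1) ∈ permsR (m + 1) := by
  classical
  have := (Finset.mem_filter.1 hs).2
  rwa [length_of_mem_permsR h] at this

theorem site_le : s ≤ m := ((mem_activeSites_iff h).1 hs).1

/-- The entry before the site is unchanged. The one entry added after it is `m + 1`, which could
only obstruct `m + 2`. -/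
theorem mem_activeSites_insert_of_le {t : ℕ} (ht : t ≤ s) :
    t ∈ activeSites (τ.insertIdx s (m + 1)) ↔ t ∈ activeSites τ := by
  have hsm := site_le h hs
  have hlen := length_of_mem_permsR h
  rw [mem_activeSites_iff (insert_mem_permsR h hs), mem_activeSites_iff h,
    insertIdx_eq_take_append_drop (by omega)]
  refine and_congr (by omega) ?_
  unfold OpenSite
  have h1 : (τ.take s ++ (m + 1) :: τ.drop s).take t = τ.take t := by
    rw [List.take_append_of_le_length (by simp; omega), List.take_take, min_eq_left ht]
  have h2 : (τ.take s ++ (m + 1) :: τ.drop s).drop t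
      = (τ.take s).drop t ++ (m + 1) :: τ.drop s := by
    rw [List.drop_append_of_le_length (by simp; omega)]
  have h3 : τ.drop t = (τ.take s).drop t ++ τ.drop s := by
    conv_lhs => rw [← List.take_append_drop s τ]
    rw [List.drop_append_of_le_length (by simp; omega)]
  rw [h1, h2, h3]
  refine forall₂_congr fun u hu => ?_
  have hum : u ≤ m := ((mem_iff_of_mem_permsR h).1
    (List.mem_of_mem_take (List.mem_of_getLast? hu))).2
  constructor
  · intro H c hc
    refine H c ?_
    simp only [List.mem_append, List.mem_cons] at hc ⊢
    tauto
  · intro H c hc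
    simp only [List.mem_append, List.mem_cons] at hc
    rcases hc with hc | rfl | hc
    · exact H c (by simp [hc])
    · omega
    · exact H c (by simp [hc])

/-- The site is preceded by `m + 1`, so its only possible obstruction is `m` further right. -/
theorem mem_activeSites_insert_succ (hm : 1 ≤ m) :
    s + 1 ∈ activeSites (τ.insertIdx s (m + 1)) ↔ m ∈ τ.take s := by
  have hsm := site_le h hs
  have hlen := length_of_mem_permsR h
  rw [mem_activeSites_iff (insert_mem_permsR h hs), and_iff_right (by omega),
    insertIdx_eq_take_append_drop (by omega)]
  have hl : (τ.take s).length = s := by simp; omega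
  have h0 : τ.take s ++ (m + 1) :: τ.drop s = (τ.take s ++ [m + 1]) ++ τ.drop s := by simp
  have h1 : (τ.take s ++ (m + 1) :: τ.drop s).take (s + 1) = τ.take s ++ [m + 1] := by
    rw [h0, List.take_left' (by simp [hl])]
  have h2 : (τ.take s ++ (m + 1) :: τ.drop s).drop (s + 1) = τ.drop s := by
    rw [h0, List.drop_left' (by simp [hl])]
  have hmem : m ∈ τ := (mem_iff_of_mem_permsR h).2 ⟨hm, le_rfl⟩
  have hnd := nodup_of_mem_permsR h
  rw [← List.take_append_drop s τ] at hmem hnd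
  rw [List.mem_append] at hmem
  have hdis := (List.nodup_append'.1 hnd).2.2
  unfold OpenSite
  rw [h1, h2]
  simp only [List.getLast?_append, List.getLast?_singleton, Option.some_or, Option.mem_some_iff,
    forall_eq']
  constructor
  · intro H
    exact hmem.resolve_right fun hd => H m hd rfl
  · intro H c hc hcm
    obtain rfl : m = c := by omega
    exact hdis H hc

theorem mem_activeSites_insert_of_gt {t : ℕ} (ht : s < t) :
    t + 1 ∈ activeSites (τ.insertIdx s (m + 1)) ↔ t ∈ activeSites τ := by
  have hsm := site_le h hs
  have hlen := length_of_mem_permsR h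
  rw [mem_activeSites_iff (insert_mem_permsR h hs), mem_activeSites_iff h,
    insertIdx_eq_take_append_drop (by omega), Nat.succ_le_succ_iff]
  refine and_congr_right fun htm => ?_
  obtain ⟨d, rfl⟩ : ∃ d, t = s + (d + 1) := ⟨t - s - 1, by omega⟩
  have hl : (τ.take s).length = s := by simp; omega
  have h1 : (τ.take s ++ (m + 1) :: τ.drop s).take (s + (d + 1) + 1)
      = τ.take s ++ (m + 1) :: (τ.drop s).take (d + 1) := by
    rw [List.take_append, List.take_of_length_le (by omega), hl,
      show s + (d + 1) + 1 - s = d + 1 + 1 by omega, List.take_succ_cons]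
  have h2 : (τ.take s ++ (m + 1) :: τ.drop s).drop (s + (d + 1) + 1)
      = τ.drop (s + (d + 1)) := by
    rw [List.drop_append, List.drop_of_length_le (by omega), hl,
      show s + (d + 1) + 1 - s = d + 1 + 1 by omega, List.drop_succ_cons, List.drop_drop,
      List.nil_append]
  have h3 : τ.take (s + (d + 1)) = τ.take s ++ (τ.drop s).take (d + 1) := by
    rw [List.take_add]
  -- Since `s < t`, the entry just before the shifted site is an entry of `τ` and not `m + 1`.
  have hne : (τ.drop s).take (d + 1) ≠ [] := by
    intro hnil
    have := congrArg List.length hnil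
    simp at this
    omega
  unfold OpenSite
  rw [h1, h2, h3]
  obtain ⟨v, V, hV⟩ := List.exists_cons_of_ne_nil hne
  rw [hV, List.getLast?_append, List.getLast?_append, List.getLast?_cons_cons,
    List.getLast?_cons]

theorem siteLabel_insert_of_le {t : ℕ} (ht : t ≤ s) :
    siteLabel (τ.insertIdx s (m + 1)) t = siteLabel τ t := by
  unfold siteLabel
  congr 1
  ext r
  simp only [Finset.mem_filter]
  constructor
  · rintro ⟨h1, h2⟩
    exact ⟨(mem_activeSites_insert_of_le h hs (by omega)).1 h1, h2⟩
  · rintro ⟨h1, h2⟩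
    exact ⟨(mem_activeSites_insert_of_le h hs (by omega)).2 h1, h2⟩

open Classical in
theorem card_activeSites_insert (hm : 1 ≤ m) :
    (activeSites (τ.insertIdx s (m + 1))).card
      = (activeSites τ).card + if m ∈ τ.take s then 1 else 0 := by
  -- The old active sites embed by a shift that skips `s + 1`; that site is counted separately.
  have key : activeSites (τ.insertIdx s (m + 1))
      = (activeSites τ).image (fun t => if t ≤ s then t else t + 1) ∪
        if m ∈ τ.take s then {s + 1} else ∅ := by
    ext t
    rw [Finset.mem_union, Finset.mem_image]
    rcases lt_trichotomy t (s + 1) with ht | rfl | ht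
    · rw [mem_activeSites_insert_of_le h hs (by omega)]
      constructor
      · intro H
        exact Or.inl ⟨t, H, by rw [if_pos (by omega)]⟩
      · rintro (⟨r, hr, hrt⟩ | H)
        · split_ifs at hrt with hc
          · exact hrt ▸ hr
          · omega
        · split_ifs at H with hc
          · simp at H; omega
          · simp at H
    · rw [mem_activeSites_insert_succ h hs hm]
      constructor
      · intro H
        right
        rw [if_pos H]
        simp
      · rintro (⟨r, hr, hrt⟩ | H)
        · split_ifs at hrt with hc <;> omega
        · split_ifs at H with hc
          · exact hc
          · simp at H
    · obtain ⟨t, rfl⟩ : ∃ t', t = t' + 1 := ⟨t - 1, by omega⟩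
      rw [mem_activeSites_insert_of_gt h hs (by omega)]
      constructor
      · intro H
        exact Or.inl ⟨t, H, by rw [if_neg (by omega)]⟩
      · rintro (⟨r, hr, hrt⟩ | H)
        · split_ifs at hrt with hc
          · omega
          · obtain rfl : r = t := by omega
            exact hr
        · split_ifs at H with hc
          · simp at H; omega
          · simp at H
  rw [key, Finset.card_union_of_disjoint, Finset.card_image_of_injective]
  · split_ifs <;> simp
  · intro a b hab
    dsimp only at hab
    split_ifs at hab <;> omega
  · split_ifs
    · rw [Finset.disjoint_singleton_right, Finset.mem_image]
      rintro ⟨r, -, hr⟩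
      split_ifs at hr <;> omega
    · simp

end Insert

/-! ### Site labels, injectivity of `Λ`, and ascent sequences -/

theorem siteLabel_mono (τ : List ℕ) : Monotone (siteLabel τ) := fun s t hst =>
  Finset.card_le_card fun r hr => by
    rw [Finset.mem_filter] at hr ⊢
    exact ⟨hr.1, by omega⟩

theorem siteLabel_lt_siteLabel {τ : List ℕ} {s t : ℕ} (hs : s ∈ activeSites τ) (hst : s < t) :
    siteLabel τ s < siteLabel τ t := by
  refine Finset.card_lt_card ⟨fun r hr => ?_, fun H => ?_⟩
  · rw [Finset.mem_filter] at hr ⊢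
    exact ⟨hr.1, by omega⟩
  · have := H (Finset.mem_filter.2 ⟨hs, hst⟩)
    simp at this

theorem siteLabel_lt_card {τ : List ℕ} {s : ℕ} (hs : s ∈ activeSites τ) :
    siteLabel τ s < (activeSites τ).card := by
  refine Finset.card_lt_card ⟨Finset.filter_subset _ _, fun H => ?_⟩
  have := H hs
  simp at this

theorem siteLabel_inj {τ : List ℕ} {s t : ℕ} (hs : s ∈ activeSites τ) (ht : t ∈ activeSites τ)
    (h : siteLabel τ s = siteLabel τ t) : s = t := by
  rcases lt_trichotomy s t with h1 | h1 | h1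
  · exact absurd h (siteLabel_lt_siteLabel hs h1).ne
  · exact h1
  · exact absurd h (siteLabel_lt_siteLabel ht h1).ne'

theorem mem_permsR_one {π : List ℕ} (h : π ∈ permsR 1) : π = [1] := by
  simpa using h.1

/-- By induction the prefix of the sequence determines the permutation without its largest entry;
the last term then determines the active site, since labels of active sites are distinct. -/
theorem Lam_injOn {n : ℕ} (hn : 1 ≤ n) : Set.InjOn (Lam n) (permsR n) := by
  induction n, hn using Nat.le_induction with
  | base =>
    intro π hπ σ hσ _
    rw [mem_permsR_one hπ, mem_permsR_one hσ]
  | succ n hn ih =>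
    obtain ⟨n, rfl⟩ : ∃ k, n = k + 1 := ⟨n - 1, by omega⟩
    intro π hπ σ hσ heq
    obtain ⟨h1, h2, h3⟩ := erase_max_mem_permsR hπ
    obtain ⟨h4, h5, h6⟩ := erase_max_mem_permsR hσ
    simp only [Lam] at heq
    obtain ⟨h7, h8⟩ := List.append_inj' heq rfl
    have h9 := ih h1 h4 h7
    rw [← h9] at h5 h6
    have h10 : π.idxOf (n + 1 + 1) = σ.idxOf (n + 1 + 1) := by
      refine siteLabel_inj h2 h5 ?_
      rw [List.singleton_inj] at h8
      rw [h8, ← h9]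
    rw [← h3, ← h6, h10]

theorem ascCount_append_singleton {l : List ℕ} (hl : l ≠ []) (x : ℕ) :
    ascCount (l ++ [x]) = ascCount l + if l.getLast hl < x then 1 else 0 := by
  obtain ⟨k, hk⟩ : ∃ k, l.length = k + 1 :=
    ⟨l.length - 1, by have := List.length_pos_iff.2 hl; omega⟩
  unfold ascCount
  rw [List.length_append, List.length_singleton, hk, Nat.add_sub_cancel, Nat.add_sub_cancel,
    Finset.range_add_one, Finset.filter_insert]
  have h1 : (Finset.range k).filter
      (fun j => (l ++ [x]).getD j 0 < (l ++ [x]).getD (j + 1) 0)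
      = (Finset.range k).filter (fun j => l.getD j 0 < l.getD (j + 1) 0) := by
    refine Finset.filter_congr fun j hj => ?_
    rw [Finset.mem_range] at hj
    rw [List.getD_append _ _ _ _ (by omega), List.getD_append _ _ _ _ (by omega)]
  have h2 : (l ++ [x]).getD k 0 = l.getLast hl := by
    rw [List.getD_append _ _ _ _ (by omega), List.getLast_eq_getElem,
      List.getD_eq_getElem _ _ (by omega)]
    simp [hk]
  have h3 : (l ++ [x]).getD (k + 1) 0 = x := by
    rw [List.getD_append_right _ _ _ _ (by omega)]
    simp [hk]
  rw [h1, h2, h3]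
  split_ifs
  · rw [Finset.card_insert_of_notMem (by simp)]
  · rfl

theorem append_singleton_mem_ascentSeqs {n x : ℕ} {l : List ℕ} (hn : 1 ≤ n)
    (hl : l ∈ ascentSeqs n) (hx : x ≤ 1 + ascCount l) : l ++ [x] ∈ ascentSeqs (n + 1) := by
  obtain ⟨h1, h2, h3⟩ := hl
  refine ⟨by simp [h1], fun _ => ?_, fun i hi hi0 => ?_⟩
  · rw [List.getElem_append_left (by omega)]
    exact h2 (by omega)
  · rcases Nat.lt_or_ge i l.length with hil | hil
    · rw [List.getElem_append_left hil, List.take_append_of_le_length hil.le]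
      exact h3 i hil hi0
    · have : i = l.length := by simp at hi; omega
      subst this
      simpa using hx

theorem activeSites_singleton_one : activeSites [1] = {0, 1} := by
  have h1 : [1] ∈ permsR 1 := mem_permsR_iff.2 ⟨by simp, by simp [AvoidsR]⟩
  ext s
  rw [mem_activeSites_iff h1]
  constructor
  · rintro ⟨h, -⟩
    simp
    omega
  · intro h
    simp only [Finset.mem_insert, Finset.mem_singleton] at h
    rcases h with rfl | rfl <;> simp [OpenSite]

/-- Labels are smaller than the number of active sites, so the ascent bound amounts to that number
being `2` plus the number of ascents. To propagate this, the position of the largest entry is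
tracked: its site remains active and its label is the last term. An insertion gains a site iff the
previous largest entry lies to the left, that is, iff the new label exceeds the last one. -/
theorem Lam_mem_ascentSeqs_aux {n : ℕ} (hn : 1 ≤ n) : ∀ π ∈ permsR n,
    Lam n π ∈ ascentSeqs n ∧ (activeSites π).card = 2 + ascCount (Lam n π) ∧
      π.idxOf n ∈ activeSites π ∧
      ∃ hne : Lam n π ≠ [], (Lam n π).getLast hne = siteLabel π (π.idxOf n) := by
  induction n, hn using Nat.le_induction with
  | base =>
    intro π hπ
    obtain rfl := mem_permsR_one hπ
    refine ⟨⟨rfl, fun _ => rfl, fun i hi hi0 => ?_⟩, ?_, ?_, by simp [Lam], ?_⟩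
    · simp [Lam] at hi
      omega
    · simp [activeSites_singleton_one, Lam, ascCount]
    · simp [activeSites_singleton_one]
    · simp [Lam, siteLabel]
  | succ n hn ih =>
    intro π hπ
    obtain ⟨h1, h2, h3⟩ := erase_max_mem_permsR hπ
    obtain ⟨k, rfl⟩ : ∃ k, n = k + 1 := ⟨n - 1, by omega⟩
    have hLam : Lam (k + 1 + 1) π = Lam (k + 1) (π.erase (k + 1 + 1)) ++
      [siteLabel (π.erase (k + 1 + 1)) (π.idxOf (k + 1 + 1))] := rfl
    set τ := π.erase (k + 1 + 1)
    set s := π.idxOf (k + 1 + 1)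
    obtain ⟨i1, i2, i3, hne, i4⟩ := ih τ h1
    have hlen := length_of_mem_permsR h1
    have hlt := siteLabel_lt_card h2
    have hmem : k + 1 ∈ τ.take s ↔ τ.idxOf (k + 1) < s := by
      have hin : k + 1 ∈ τ := (mem_iff_of_mem_permsR h1).2 (by omega)
      have hlt : τ.idxOf (k + 1) < τ.length := List.idxOf_lt_length_iff.2 hin
      constructor
      · intro H
        obtain ⟨j, hj, hje⟩ := List.getElem_of_mem H
        rw [List.getElem_take] at hje
        simp only [List.length_take] at hj
        have : τ.idxOf (k + 1) = j := by
          rw [← hje]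
          exact (nodup_of_mem_permsR h1).idxOf_getElem j (by omega)
        omega
      · intro H
        have hx : τ[τ.idxOf (k + 1)] = k + 1 := List.getElem_idxOf hlt
        rw [List.mem_iff_getElem]
        refine ⟨τ.idxOf (k + 1), by simp; omega, by rw [List.getElem_take]; exact hx⟩
    refine ⟨?_, ?_, ?_, ?_⟩
    · rw [hLam]
      exact append_singleton_mem_ascentSeqs hn i1 (by omega)
    · conv_lhs => rw [← h3]
      rw [card_activeSites_insert h1 h2 hn, hLam, ascCount_append_singleton hne, i2, i4, add_assoc]
      congr 2
      refine if_congr ?_ rfl rfl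
      rw [hmem]
      -- Strictness needs the site of the old largest entry to be active, which is why the induction
      -- carries that fact.
      refine ⟨siteLabel_lt_siteLabel i3, fun H => ?_⟩
      by_contra hcon
      exact absurd (siteLabel_mono τ (not_lt.1 hcon)) (not_le.2 H)
    · rw [← h3]
      exact (mem_activeSites_insert_of_le h1 h2 le_rfl).2 h2
    · refine ⟨by simp [hLam], ?_⟩
      simp only [hLam, List.getLast_append_singleton]
      rw [← h3]
      exact (siteLabel_insert_of_le h1 h2 le_rfl).symm

theorem Lam_mem_ascentSeqs {n : ℕ} (hn : 1 ≤ n) {π : List ℕ} (hπ : π ∈ permsR n) :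
    Lam n π ∈ ascentSeqs n :=
  (Lam_mem_ascentSeqs_aux hn π hπ).1

theorem Lam_insertIdx {m s : ℕ} {τ : List ℕ} (hm : 1 ≤ m) (h : τ ∈ permsR m)
    (hs : s ∈ activeSites τ) :
    Lam (m + 1) (τ.insertIdx s (m + 1)) = Lam m τ ++ [siteLabel τ s] := by
  obtain ⟨k, rfl⟩ : ∃ k, m = k + 1 := ⟨m - 1, by omega⟩
  have hsm := site_le h hs
  have hlen := length_of_mem_permsR h
  have hnot : k + 1 + 1 ∉ τ := fun H => by
    have := (mem_iff_of_mem_permsR h).1 H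
    omega
  have hidx : (τ.insertIdx s (k + 1 + 1)).idxOf (k + 1 + 1) = s := by
    rw [insertIdx_eq_take_append_drop (by omega), List.idxOf_append_of_notMem
      (fun H => hnot (List.mem_of_mem_take H))]
    simp
    omega
  have her : (τ.insertIdx s (k + 1 + 1)).erase (k + 1 + 1) = τ := by
    rw [insertIdx_eq_take_append_drop (by omega), List.erase_append_right _
      (fun H => hnot (List.mem_of_mem_take H))]
    simp
  simp only [Lam, her, hidx]

/-! ### Predecessor sets and levels -/

theorem FinPoset.of_carrier (P : Type*) [Fintype P] [PartialOrder P] :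
    (FinPoset.of P).carrier = Finset.univ := rfl

namespace FinPoset

section Basic

variable {α : Type*} {P : FinPoset α}

theorem mem_pred {x y : α} : y ∈ P.pred x ↔ y ∈ P.carrier ∧ P.lt y x := by
  classical
  exact Finset.mem_filter

theorem mem_levelSet {x : α} {j : ℕ} : x ∈ P.levelSet j ↔ x ∈ P.carrier ∧ P.level x = j := by
  classical
  exact Finset.mem_filter

theorem mem_predSets {D : Finset α} : D ∈ P.predSets ↔ ∃ x ∈ P.carrier, P.pred x = D := by
  classical
  exact Finset.mem_image

theorem pred_mem_predSets {x : α} (hx : x ∈ P.carrier) : P.pred x ∈ P.predSets :=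
  mem_predSets.2 ⟨x, hx, rfl⟩

theorem mem_predAt {y : α} {j : ℕ} :
    y ∈ P.predAt j ↔ y ∈ P.carrier ∧ ∃ x ∈ P.levelSet j, P.lt y x := by
  classical
  exact Finset.mem_filter

theorem pred_ssubset_of_lt {x y : α} (hx : x ∈ P.carrier) (h : P.lt x y) :
    P.pred x ⊂ P.pred y := by
  refine ⟨fun z hz => ?_, fun H => ?_⟩
  · rw [mem_pred] at hz ⊢
    exact ⟨hz.1, P.trans _ _ _ hz.2 h⟩
  · exact P.irrefl x (mem_pred.1 (H (mem_pred.2 ⟨hx, h⟩))).2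

theorem exists_isMaxElt (h : P.carrier.Nonempty) : ∃ x, P.IsMaxElt x := by
  obtain ⟨x, hx, hmax⟩ := P.carrier.exists_max_image (fun y => (P.pred y).card) h
  exact ⟨x, hx, fun y hy hxy =>
    absurd (hmax y hy) (not_le.2 (Finset.card_lt_card (pred_ssubset_of_lt hx hxy)))⟩

theorem exists_removable (h : P.carrier.Nonempty) : ∃ x, P.Removable x := by
  obtain ⟨x, hx⟩ := exists_isMaxElt h
  have : P.srank ∈ {i | ∃ x, P.IsMaxElt x ∧ P.level x = i} := Nat.sInf_mem ⟨_, x, hx, rfl⟩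
  obtain ⟨y, hy, hyl⟩ := this
  exact ⟨y, hy, hyl⟩

theorem srank_le {x : α} (hx : P.IsMaxElt x) : P.srank ≤ P.level x := Nat.sInf_le ⟨x, hx, rfl⟩

theorem mem_remove_carrier {x y : α} : y ∈ (P.remove x).carrier ↔ y ≠ x ∧ y ∈ P.carrier := by
  classical
  exact Finset.mem_erase

theorem card_remove {x : α} (hx : x ∈ P.carrier) :
    (P.remove x).carrier.card + 1 = P.carrier.card := by
  classical
  exact Finset.card_erase_add_one hx

/-- The predecessor sets form a chain. -/
def IsNested (P : FinPoset α) : Prop :=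
  ∀ x ∈ P.carrier, ∀ y ∈ P.carrier, P.pred x ⊆ P.pred y ∨ P.pred y ⊆ P.pred x

/-- A function on the elements that is strictly increasing in the predecessor set and takes
exactly the values `0, …, r` is the level function. -/
theorem rank_level_unique {f : α → ℕ} {r : ℕ}
    (hlt : ∀ y ∈ P.carrier, ∀ z ∈ P.carrier, f y < f z → P.pred y ⊂ P.pred z)
    (heq : ∀ y ∈ P.carrier, ∀ z ∈ P.carrier, f y = f z → P.pred y = P.pred z)
    (himg : ∀ j, (∃ y ∈ P.carrier, f y = j) ↔ j ≤ r) :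
    P.rank = r ∧ (∀ y ∈ P.carrier, P.level y = f y) ∧ P.IsNested := by
  classical
  -- A representative `g j` of each value `j ≤ r` turns predecessor sets into an indexed chain, so
  -- that rank and levels become cardinalities of ranges.
  have hg : ∀ j, ∃ y, j ≤ r → y ∈ P.carrier ∧ f y = j := by
    intro j
    by_cases hj : j ≤ r
    · obtain ⟨y, hy⟩ := (himg j).2 hj
      exact ⟨y, fun _ => hy⟩
    · obtain ⟨y, -⟩ := (himg 0).2 (Nat.zero_le r)
      exact ⟨y, fun h => absurd h hj⟩
  choose g hg using hg
  have hinj : ∀ a ≤ r, ∀ b ≤ r, P.pred (g a) = P.pred (g b) → a = b := by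
    intro a ha b hb hab
    obtain ⟨h1, h2⟩ := hg a ha
    obtain ⟨h3, h4⟩ := hg b hb
    rcases lt_trichotomy a b with h | h | h
    · exact absurd hab (hlt _ h1 _ h3 (by omega)).ne
    · exact h
    · exact absurd hab (hlt _ h3 _ h1 (by omega)).ne'
  have hle : ∀ y ∈ P.carrier, f y ≤ r := fun y hy => (himg _).1 ⟨y, hy, rfl⟩
  have hcard : ∀ m ≤ r + 1, ((Finset.range m).image fun j => P.pred (g j)).card = m := by
    intro m hm
    rw [Finset.card_image_of_injOn, Finset.card_range]
    intro a ha b hb hab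
    simp only [Finset.coe_range, Set.mem_Iio] at ha hb
    exact hinj a (by omega) b (by omega) hab
  refine ⟨?_, ?_, ?_⟩
  · have : P.predSets = (Finset.range (r + 1)).image fun j => P.pred (g j) := by
      ext D
      rw [mem_predSets, Finset.mem_image]
      constructor
      · rintro ⟨y, hy, rfl⟩
        obtain ⟨h1, h2⟩ := hg (f y) (hle y hy)
        exact ⟨f y, Finset.mem_range.2 (Nat.lt_succ_of_le (hle y hy)), heq _ h1 _ hy h2⟩
      · rintro ⟨j, hj, rfl⟩
        exact ⟨g j, (hg j (Nat.le_of_lt_succ (Finset.mem_range.1 hj))).1, rfl⟩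
    rw [rank, this, hcard _ le_rfl, Nat.add_sub_cancel]
  · intro y hy
    have : P.predSets.filter (fun D => D ⊂ P.pred y)
        = (Finset.range (f y)).image fun j => P.pred (g j) := by
      ext D
      rw [Finset.mem_filter, mem_predSets, Finset.mem_image]
      constructor
      · rintro ⟨⟨z, hz, rfl⟩, hzy⟩
        obtain ⟨h1, h2⟩ := hg (f z) (hle z hz)
        refine ⟨f z, Finset.mem_range.2 ?_, heq _ h1 _ hz h2⟩
        by_contra hcon
        rcases (not_lt.1 hcon).lt_or_eq with h | h
        · exact hzy.2 (hlt _ hy _ hz h).1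
        · exact hzy.ne (heq _ hz _ hy h.symm)
      · rintro ⟨j, hj, rfl⟩
        rw [Finset.mem_range] at hj
        obtain ⟨h1, h2⟩ := hg j (hj.le.trans (hle y hy))
        exact ⟨⟨g j, h1, rfl⟩, hlt _ h1 _ hy (by omega)⟩
    rw [level, ← hcard (f y) ((hle y hy).trans (Nat.le_succ r)), ← this]
  · intro y hy z hz
    rcases lt_trichotomy (f y) (f z) with h | h | h
    · exact Or.inl (hlt _ hy _ hz h).1
    · exact Or.inl (heq _ hy _ hz h).subset
    · exact Or.inr (hlt _ hz _ hy h).1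

theorem level_le_of_pred_subset {y z : α} (h : P.pred y ⊆ P.pred z) : P.level y ≤ P.level z := by
  classical
  refine Finset.card_le_card fun D hD => ?_
  rw [Finset.mem_filter] at hD ⊢
  exact ⟨hD.1, hD.2.trans_subset h⟩

theorem level_lt_of_pred_ssubset {y z : α} (hy : y ∈ P.carrier) (h : P.pred y ⊂ P.pred z) :
    P.level y < P.level z := by
  classical
  refine Finset.card_lt_card ⟨fun D hD => ?_, fun H => ?_⟩
  · rw [Finset.mem_filter] at hD ⊢
    exact ⟨hD.1, hD.2.trans h⟩
  · have := H (Finset.mem_filter.2 ⟨pred_mem_predSets hy, h⟩)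
    exact (Finset.mem_filter.1 this).2.ne rfl

theorem IsNested.pred_ssubset (hP : P.IsNested) {y z : α} (hy : y ∈ P.carrier)
    (hz : z ∈ P.carrier) (h : P.level y < P.level z) : P.pred y ⊂ P.pred z := by
  have hn : ¬ P.pred z ⊆ P.pred y := fun H => absurd (level_le_of_pred_subset H) (not_le.2 h)
  exact ⟨(hP y hy z hz).resolve_right hn, hn⟩

theorem IsNested.pred_eq (hP : P.IsNested) {y z : α} (hy : y ∈ P.carrier)
    (hz : z ∈ P.carrier) (h : P.level y = P.level z) : P.pred y = P.pred z := by
  by_contra hne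
  rcases hP y hy z hz with H | H
  · exact absurd h (level_lt_of_pred_ssubset hy (H.ssubset_of_ne hne)).ne
  · exact absurd h (level_lt_of_pred_ssubset hz (H.ssubset_of_ne (Ne.symm hne))).ne'

theorem IsNested.pred_subset (hP : P.IsNested) {y z : α} (hy : y ∈ P.carrier)
    (hz : z ∈ P.carrier) (h : P.level y ≤ P.level z) : P.pred y ⊆ P.pred z := by
  rcases h.lt_or_eq with h | h
  · exact (hP.pred_ssubset hy hz h).1
  · exact (hP.pred_eq hy hz h).subset

/-- Levels map the predecessor sets injectively into `{0, …, rank}`, a set of the same size, so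
every level occurs. -/
theorem IsNested.exists_level_iff (hP : P.IsNested) (hne : P.carrier.Nonempty) (j : ℕ) :
    (∃ y ∈ P.carrier, P.level y = j) ↔ j ≤ P.rank := by
  classical
  have hpos : 0 < P.predSets.card :=
    Finset.card_pos.2 ⟨_, pred_mem_predSets hne.choose_spec⟩
  have hrank : P.rank + 1 = P.predSets.card := by
    rw [rank]
    omega
  let lev : Finset α → ℕ := fun D => (P.predSets.filter (fun E => E ⊂ D)).card
  have hlev : ∀ y, lev (P.pred y) = P.level y := fun y => by
    simp only [lev, level]
  have hinj : Set.InjOn lev P.predSets := by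
    intro D hD E hE h
    obtain ⟨y, hy, rfl⟩ := mem_predSets.1 hD
    obtain ⟨z, hz, rfl⟩ := mem_predSets.1 hE
    rw [hlev, hlev] at h
    exact hP.pred_eq hy hz h
  have himg : P.predSets.image lev = Finset.range (P.rank + 1) := by
    refine Finset.eq_of_subset_of_card_le (fun j hj => ?_) ?_
    · obtain ⟨D, hD, rfl⟩ := Finset.mem_image.1 hj
      rw [Finset.mem_range, hrank]
      refine Finset.card_lt_card ⟨Finset.filter_subset _ _, fun H => ?_⟩
      exact (Finset.mem_filter.1 (H hD)).2.ne rfl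
    · rw [Finset.card_image_of_injOn hinj, Finset.card_range, hrank]
  rw [← Nat.lt_succ_iff, ← Finset.mem_range, ← Nat.succ_eq_add_one] at *
  rw [← himg, Finset.mem_image]
  constructor
  · rintro ⟨y, hy, rfl⟩
    exact ⟨_, pred_mem_predSets hy, hlev y⟩
  · rintro ⟨D, hD, rfl⟩
    obtain ⟨y, hy, rfl⟩ := mem_predSets.1 hD
    exact ⟨y, hy, (hlev y).symm⟩

theorem IsNested.level_le_rank (hP : P.IsNested) {y : α} (hy : y ∈ P.carrier) :
    P.level y ≤ P.rank :=
  (hP.exists_level_iff ⟨y, hy⟩ _).1 ⟨y, hy, rfl⟩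

theorem IsNested.predAt_level (hP : P.IsNested) {z : α} (hz : z ∈ P.carrier) :
    P.predAt (P.level z) = P.pred z := by
  ext y
  rw [mem_predAt, mem_pred]
  refine and_congr_right fun hy => ⟨?_, fun h => ⟨z, mem_levelSet.2 ⟨hz, rfl⟩, h⟩⟩
  rintro ⟨x, hx, hyx⟩
  obtain ⟨hx, hxl⟩ := mem_levelSet.1 hx
  exact (mem_pred.1 (hP.pred_eq hx hz hxl ▸ mem_pred.2 ⟨hy, hyx⟩)).2

end Basic

/-! ### Effect of a removal on levels -/

section Remove

variable {α : Type*} {P : FinPoset α} {x : α}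

/-- A maximal element lies in no predecessor set, so only the deleted relations can shrink one. -/
theorem mem_pred_remove (hx : P.IsMaxElt x) {y z : α} (hz : z ∈ P.carrier) :
    y ∈ (P.remove x).pred z ↔ y ∈ P.pred z ∧
      ¬ ((P.levelSet (P.level x)).card = 1 ∧ P.level x < P.rank ∧
        y ∈ P.predAt (P.level x + 1) ∧ y ∉ P.predAt (P.level x)) := by
  classical
  have h1 : (P.remove x).lt y z ↔ P.lt y z ∧
      ¬ ((P.levelSet (P.level x)).card = 1 ∧ P.level x < P.rank ∧
        y ∈ P.predAt (P.level x + 1) ∧ y ∉ P.predAt (P.level x)) := by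
    rw [← Finset.mem_sdiff]
    constructor <;>
    · rintro ⟨h1, h2⟩
      refine ⟨h1, ?_⟩
      convert h2
  rw [mem_pred, mem_pred, mem_remove_carrier, h1]
  constructor
  · rintro ⟨⟨-, h2⟩, h3, h4⟩
    exact ⟨⟨h2, h3⟩, h4⟩
  · rintro ⟨⟨h2, h3⟩, h4⟩
    exact ⟨⟨fun h => hx.2 z hz (h ▸ h3), h2⟩, h3, h4⟩

/-- If the removed element is not alone at its level, then the levels do not change. -/
theorem IsNested.remove_of_card_ne_one (hP : P.IsNested) (hx : P.IsMaxElt x)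
    (hc : (P.levelSet (P.level x)).card ≠ 1) :
    (P.remove x).rank = P.rank ∧ (∀ y ∈ (P.remove x).carrier, (P.remove x).level y = P.level y) ∧
      (P.remove x).IsNested := by
  have hpred : ∀ y ∈ P.carrier, (P.remove x).pred y = P.pred y := fun y hy => by
    ext z
    rw [mem_pred_remove hx hy]
    tauto
  have hmem : ∀ y ∈ (P.remove x).carrier, y ∈ P.carrier := fun y hy => (mem_remove_carrier.1 hy).2
  refine rank_level_unique ?_ ?_ ?_
  · intro y hy z hz h
    rw [hpred y (hmem y hy), hpred z (hmem z hz)]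
    exact hP.pred_ssubset (hmem y hy) (hmem z hz) h
  · intro y hy z hz h
    rw [hpred y (hmem y hy), hpred z (hmem z hz)]
    exact hP.pred_eq (hmem y hy) (hmem z hz) h
  · intro j
    rw [← hP.exists_level_iff ⟨x, hx.1⟩]
    constructor
    · rintro ⟨y, hy, h⟩
      exact ⟨y, hmem y hy, h⟩
    · rintro ⟨y, hy, h⟩
      by_cases hyx : y = x
      · subst hyx
        have h1 : 0 < (P.levelSet (P.level y)).card :=
          Finset.card_pos.2 ⟨y, mem_levelSet.2 ⟨hx.1, rfl⟩⟩
        obtain ⟨z, hz, hzy⟩ := Finset.exists_mem_ne (by omega : 1 < (P.levelSet (P.level y)).card) y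
        obtain ⟨hz, hzl⟩ := mem_levelSet.1 hz
        exact ⟨z, mem_remove_carrier.2 ⟨hzy, hz⟩, hzl.trans h⟩
      · exact ⟨y, mem_remove_carrier.2 ⟨hyx, hy⟩, h⟩

theorem level_ne_of_card_eq_one (hx : x ∈ P.carrier) (hc : (P.levelSet (P.level x)).card = 1)
    {y : α} (hy : y ∈ (P.remove x).carrier) : P.level y ≠ P.level x := by
  intro h
  obtain ⟨hyx, hy⟩ := mem_remove_carrier.1 hy
  exact hyx (Finset.card_le_one.1 hc.le y (mem_levelSet.2 ⟨hy, h⟩) x (mem_levelSet.2 ⟨hx, rfl⟩))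

/-- If the removed element is alone at its level, then this level disappears. -/
theorem IsNested.remove_of_card_eq_one (hP : P.IsNested) (hx : P.IsMaxElt x)
    (hcard : 2 ≤ P.carrier.card) (hc : (P.levelSet (P.level x)).card = 1) :
    (P.remove x).rank + 1 = P.rank ∧
      (∀ y ∈ (P.remove x).carrier,
        (P.remove x).level y = if P.level y < P.level x then P.level y else P.level y - 1) ∧
      (P.remove x).IsNested := by
  classical
  have hmem : ∀ y ∈ (P.remove x).carrier, y ∈ P.carrier := fun y hy => (mem_remove_carrier.1 hy).2
  have hne := fun y => level_ne_of_card_eq_one hx.1 hc (y := y)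
  have hpred : ∀ y ∈ P.carrier, ∀ z, z ∈ (P.remove x).pred y ↔ z ∈ P.pred y ∧
      ¬ (P.level x < P.rank ∧ z ∈ P.predAt (P.level x + 1) ∧ z ∉ P.pred x) := fun y hy z => by
    rw [mem_pred_remove hx hy, hP.predAt_level hx.1]
    tauto
  have hNsub : P.level x < P.rank → ∀ y ∈ P.carrier, P.level x < P.level y →
      P.predAt (P.level x + 1) ⊆ P.pred y := by
    intro hr y hy h
    obtain ⟨w, hw, hwl⟩ := (hP.exists_level_iff ⟨x, hx.1⟩ _).2 (Nat.succ_le_of_lt hr)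
    have := hP.predAt_level hw
    rw [hwl] at this
    rw [this]
    exact hP.pred_subset hw hy (by omega)
  have hmono : ∀ y ∈ P.carrier, ∀ z ∈ P.carrier, P.pred y ⊆ P.pred z →
      (P.remove x).pred y ⊆ (P.remove x).pred z := by
    intro y hy z hz h w hw
    rw [hpred y hy] at hw
    rw [hpred z hz]
    exact ⟨h hw.1, hw.2⟩
  have hrank : 1 ≤ P.rank := by
    obtain ⟨y, hy, hyx⟩ := Finset.exists_mem_ne (by omega : 1 < P.carrier.card) x
    have h1 := hP.level_le_rank hy
    have h2 := hP.level_le_rank hx.1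
    have h3 := hne y (mem_remove_carrier.2 ⟨hyx, hy⟩)
    omega
  suffices H : (P.remove x).rank = P.rank - 1 ∧
      (∀ y ∈ (P.remove x).carrier,
        (P.remove x).level y = if P.level y < P.level x then P.level y else P.level y - 1) ∧
      (P.remove x).IsNested from ⟨by omega, H.2⟩
  refine rank_level_unique ?_ ?_ ?_
  · intro y hy z hz h
    have hlt : P.level y < P.level z := by
      have := hne y hy
      have := hne z hz
      split_ifs at h <;> omega
    have hyP := hmem y hy
    have hzP := hmem z hz
    have hss := hP.pred_ssubset hyP hzP hlt
    refine ⟨hmono y hyP z hzP hss.1, fun H => ?_⟩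
    -- The inclusion must stay strict, so a witness outside `D_{i+1} \ D_i` is needed, where `i` is
    -- the level of `x`. If both levels are below `i`, any witness lies in `D_i`. If they straddle
    -- `i`, one is taken from `D_i`. If both are above `i`, then `D_{i+1}` is contained in the
    -- smaller set and any witness avoids it.
    obtain ⟨w, hwz, hwy, hwN⟩ : ∃ w, w ∈ P.pred z ∧ w ∉ P.pred y ∧
        ¬ (P.level x < P.rank ∧ w ∈ P.predAt (P.level x + 1) ∧ w ∉ P.pred x) := by
      rcases lt_or_ge (P.level y) (P.level x) with h1 | h1
      · rcases lt_or_ge (P.level z) (P.level x) with h2 | h2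
        · obtain ⟨w, hwz, hwy⟩ := Finset.exists_of_ssubset hss
          exact ⟨w, hwz, hwy, fun hN => hN.2.2 (hP.pred_subset hzP hx.1 h2.le hwz)⟩
        · obtain ⟨w, hwx, hwy⟩ := Finset.exists_of_ssubset (hP.pred_ssubset hyP hx.1 h1)
          exact ⟨w, hP.pred_subset hx.1 hzP h2 hwx, hwy, fun hN => hN.2.2 hwx⟩
      · obtain ⟨w, hwz, hwy⟩ := Finset.exists_of_ssubset hss
        refine ⟨w, hwz, hwy, fun hN => hwy (hNsub hN.1 y hyP ?_ hN.2.1)⟩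
        have := hne y hy
        omega
    exact hwy ((hpred y hyP w).1 (H ((hpred z hzP w).2 ⟨hwz, hwN⟩))).1
  · intro y hy z hz h
    have hlt : P.level y = P.level z := by
      have := hne y hy
      have := hne z hz
      split_ifs at h <;> omega
    have hyP := hmem y hy
    have hzP := hmem z hz
    have := hP.pred_eq hyP hzP hlt
    exact (hmono y hyP z hzP this.subset).antisymm (hmono z hzP y hyP this.symm.subset)
  · intro j
    constructor
    · rintro ⟨y, hy, rfl⟩
      have h1 := hP.level_le_rank (hmem y hy)
      have h2 := hP.level_le_rank hx.1
      split_ifs <;> omega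
    · intro hj
      have hex : ∀ l ≤ P.rank, l ≠ P.level x → ∃ y ∈ (P.remove x).carrier, P.level y = l := by
        intro l hl hlx
        obtain ⟨y, hy, hyl⟩ := (hP.exists_level_iff ⟨x, hx.1⟩ l).2 hl
        refine ⟨y, mem_remove_carrier.2 ⟨?_, hy⟩, hyl⟩
        rintro rfl
        exact hlx hyl.symm
      by_cases hjx : j < P.level x
      · obtain ⟨y, hy, hyl⟩ := hex j (by omega) (by omega)
        exact ⟨y, hy, by rw [if_pos (by omega), hyl]⟩
      · obtain ⟨y, hy, hyl⟩ := hex (j + 1) (by omega) (by omega)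
        exact ⟨y, hy, by rw [if_neg (by omega), hyl, Nat.add_sub_cancel]⟩

theorem IsNested.remove (hP : P.IsNested) (hx : P.IsMaxElt x) (hcard : 2 ≤ P.carrier.card) :
    (P.remove x).IsNested := by
  by_cases hc : (P.levelSet (P.level x)).card = 1
  · exact (hP.remove_of_card_eq_one hx hcard hc).2.2
  · exact (hP.remove_of_card_ne_one hx hc).2.2

theorem remove_nonempty (hx : x ∈ P.carrier) (hcard : 2 ≤ P.carrier.card) :
    (P.remove x).carrier.Nonempty := by
  have := card_remove hx
  exact Finset.card_pos.1 (by omega)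

/-- The next removal takes place at a strictly lower level iff the level of the removed element
disappears. -/
theorem IsNested.srank_remove_lt_iff (hP : P.IsNested) (hx : P.Removable x)
    (hcard : 2 ≤ P.carrier.card) :
    (P.remove x).srank < P.srank ↔ (P.levelSet (P.level x)).card = 1 := by
  have hQne := remove_nonempty hx.1.1 hcard
  constructor
  · intro hlt
    by_contra hc
    obtain ⟨-, hlev, -⟩ := hP.remove_of_card_ne_one hx.1 hc
    obtain ⟨w, hw, hws⟩ := exists_removable hQne
    obtain ⟨hwx, hwP⟩ := mem_remove_carrier.1 hw.1
    have key : ∀ z ∈ (P.remove x).carrier, ¬ P.lt w z := by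
      intro z hz hwz
      have hzP := (mem_remove_carrier.1 hz).2
      refine hw.2 z hz (mem_pred.1 ?_).2
      rw [mem_pred_remove hx.1 hzP]
      exact ⟨mem_pred.2 ⟨hwP, hwz⟩, fun h => hc h.1⟩
    have hmax : P.IsMaxElt w := by
      refine ⟨hwP, fun z hz hwz => ?_⟩
      -- Could `x` be the only element above `w`? No: another element at the level of `x` has the
      -- same predecessors and survives. So `w` is maximal in `P`, contradicting the minimality of
      -- the level of `x`.
      by_cases hzx : z = x
      · subst hzx
        have h1 : 0 < (P.levelSet (P.level z)).card :=
          Finset.card_pos.2 ⟨z, mem_levelSet.2 ⟨hz, rfl⟩⟩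
        obtain ⟨y, hy, hyz⟩ := Finset.exists_mem_ne (by omega : 1 < (P.levelSet (P.level z)).card) z
        obtain ⟨hy, hyl⟩ := mem_levelSet.1 hy
        refine key y (mem_remove_carrier.2 ⟨hyz, hy⟩) (mem_pred.1 ?_).2
        rw [hP.pred_eq hy hz hyl]
        exact mem_pred.2 ⟨hwP, hwz⟩
      · exact key z (mem_remove_carrier.2 ⟨hzx, hz⟩) hwz
    have := srank_le hmax
    rw [← hlev w hw.1, hws] at this
    omega
  · intro hc
    obtain ⟨hr, hlev, hQ⟩ := hP.remove_of_card_eq_one hx.1 hcard hc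
    rw [← hx.2]
    by_cases hxr : P.level x < P.rank
    · obtain ⟨z, hz, hzl⟩ := (hP.exists_level_iff ⟨x, hx.1.1⟩ _).2 (Nat.succ_le_of_lt hxr)
      -- An element `y` of `D_{i+1} \ D_i` becomes maximal, since all relations above it are
      -- deleted. Its level is below `i`: it cannot be `i`, where `x` is alone, and a higher level
      -- would put `y` in its own predecessor set.
      obtain ⟨y, hyz, hyx⟩ := Finset.exists_of_ssubset
        (hP.pred_ssubset hx.1.1 hz (by omega : P.level x < P.level z))
      obtain ⟨hyP, hylt⟩ := mem_pred.1 hyz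
      have hyQ : y ∈ (P.remove x).carrier := by
        refine mem_remove_carrier.2 ⟨?_, hyP⟩
        rintro rfl
        exact hx.1.2 z hz hylt
      have hyl : P.level y < P.level x := by
        by_contra hcon
        have h1 := level_ne_of_card_eq_one hx.1.1 hc hyQ
        have h2 := hP.pred_subset hz hyP (by omega) hyz
        exact P.irrefl y (mem_pred.1 h2).2
      have hmax : (P.remove x).IsMaxElt y := by
        refine ⟨hyQ, fun w hw hyw => ?_⟩
        have hwP := (mem_remove_carrier.1 hw).2
        have := (mem_pred_remove hx.1 hwP).1 (mem_pred.2 ⟨hyQ, hyw⟩)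
        refine this.2 ⟨hc, hxr, ?_, ?_⟩
        · have h3 := hP.predAt_level hz
          rw [hzl] at h3
          exact h3 ▸ hyz
        · rwa [hP.predAt_level hx.1.1]
      have h1 := srank_le hmax
      rw [hlev y hyQ, if_pos hyl] at h1
      omega
    -- Here the top level vanishes, so every remaining level is smaller.
    · obtain ⟨w, hw, hws⟩ := exists_removable hQne
      have h1 := hQ.level_le_rank hw.1
      omega

end Remove

/-! ### Independence of `Ψ` from the choice of removed element -/

section Iso

variable {α : Type*} {P Q : FinPoset α} {e : Equiv.Perm α}

/-- The permutation `e` of the ambient type restricts to an isomorphism from `P` to `Q`. -/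
structure IsIsoVia (e : Equiv.Perm α) (P Q : FinPoset α) : Prop where
  mem_iff : ∀ a, e a ∈ Q.carrier ↔ a ∈ P.carrier
  lt_iff : ∀ a ∈ P.carrier, ∀ b ∈ P.carrier, (Q.lt (e a) (e b) ↔ P.lt a b)

namespace IsIsoVia

theorem trans {R : FinPoset α} {f : Equiv.Perm α} (h : IsIsoVia e P Q) (h' : IsIsoVia f Q R) :
    IsIsoVia (e.trans f) P R where
  mem_iff a := by simp [h.mem_iff, h'.mem_iff]
  lt_iff a ha b hb := by
    simp only [Equiv.trans_apply]
    rw [h'.lt_iff _ ((h.mem_iff a).2 ha) _ ((h.mem_iff b).2 hb), h.lt_iff a ha b hb]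

theorem eq_map {s t : Finset α} (h : ∀ a, e a ∈ t ↔ a ∈ s) : t = s.map e.toEmbedding := by
  ext b
  obtain ⟨a, rfl⟩ := e.surjective b
  simp [h]

variable (h : IsIsoVia e P Q)
include h

theorem mem_pred_iff {a b : α} (hb : b ∈ P.carrier) : e a ∈ Q.pred (e b) ↔ a ∈ P.pred b := by
  rw [mem_pred, mem_pred, h.mem_iff]
  exact and_congr_right fun ha => h.lt_iff a ha b hb

theorem pred_eq {b : α} (hb : b ∈ P.carrier) : Q.pred (e b) = (P.pred b).map e.toEmbedding :=
  eq_map fun _ => h.mem_pred_iff hb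

theorem predSets_eq :
    Q.predSets = P.predSets.map (Finset.mapEmbedding e.toEmbedding).toEmbedding := by
  ext D
  simp only [mem_predSets, Finset.mem_map, RelEmbedding.coe_toEmbedding,
    Finset.mapEmbedding_apply]
  constructor
  · rintro ⟨b, hb, rfl⟩
    obtain ⟨a, rfl⟩ := e.surjective b
    have ha := (h.mem_iff a).1 hb
    exact ⟨_, ⟨a, ha, rfl⟩, (h.pred_eq ha).symm⟩
  · rintro ⟨_, ⟨a, ha, rfl⟩, rfl⟩
    exact ⟨e a, (h.mem_iff a).2 ha, h.pred_eq ha⟩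

theorem rank_eq : Q.rank = P.rank := by
  rw [rank, rank, h.predSets_eq, Finset.card_map]

theorem level_eq {b : α} (hb : b ∈ P.carrier) : Q.level (e b) = P.level b := by
  classical
  rw [level, level, h.predSets_eq, h.pred_eq hb, Finset.filter_map, Finset.card_map]
  congr 1
  refine Finset.filter_congr fun D _ => ?_
  simp [Finset.map_ssubset_map]

theorem mem_levelSet_iff {a : α} {j : ℕ} : e a ∈ Q.levelSet j ↔ a ∈ P.levelSet j := by
  rw [mem_levelSet, mem_levelSet, h.mem_iff]
  exact and_congr_right fun ha => by rw [h.level_eq ha]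

theorem card_levelSet_eq (j : ℕ) : (Q.levelSet j).card = (P.levelSet j).card := by
  rw [eq_map fun _ => h.mem_levelSet_iff, Finset.card_map]

theorem mem_predAt_iff {a : α} {j : ℕ} : e a ∈ Q.predAt j ↔ a ∈ P.predAt j := by
  rw [mem_predAt, mem_predAt, h.mem_iff]
  refine and_congr_right fun ha => ?_
  constructor
  · rintro ⟨b, hb, hab⟩
    obtain ⟨b, rfl⟩ := e.surjective b
    have hb' := h.mem_levelSet_iff.1 hb
    exact ⟨b, hb', (h.lt_iff a ha b (mem_levelSet.1 hb').1).1 hab⟩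
  · rintro ⟨b, hb, hab⟩
    exact ⟨e b, h.mem_levelSet_iff.2 hb, (h.lt_iff a ha b (mem_levelSet.1 hb).1).2 hab⟩

theorem isMaxElt_iff {a : α} : Q.IsMaxElt (e a) ↔ P.IsMaxElt a := by
  unfold IsMaxElt
  rw [h.mem_iff]
  refine and_congr_right fun ha => ?_
  constructor
  · intro H b hb hab
    exact H (e b) ((h.mem_iff b).2 hb) ((h.lt_iff a ha b hb).2 hab)
  · intro H b hb hab
    obtain ⟨b, rfl⟩ := e.surjective b
    have hb' := (h.mem_iff b).1 hb
    exact H b hb' ((h.lt_iff a ha b hb').1 hab)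

theorem srank_eq : Q.srank = P.srank := by
  unfold srank
  congr 1
  ext i
  constructor
  · rintro ⟨b, hb, rfl⟩
    obtain ⟨a, rfl⟩ := e.surjective b
    have ha := h.isMaxElt_iff.1 hb
    exact ⟨a, ha, (h.level_eq ha.1).symm⟩
  · rintro ⟨a, ha, rfl⟩
    exact ⟨e a, h.isMaxElt_iff.2 ha, h.level_eq ha.1⟩

theorem removable_iff {a : α} : Q.Removable (e a) ↔ P.Removable a := by
  unfold Removable
  rw [h.isMaxElt_iff, h.srank_eq]
  exact and_congr_right fun ha => by rw [h.level_eq ha.1]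

theorem remove {x : α} (hx : x ∈ P.carrier) : IsIsoVia e (P.remove x) (Q.remove (e x)) where
  mem_iff a := by
    rw [mem_remove_carrier, mem_remove_carrier, h.mem_iff, e.injective.ne_iff]
  lt_iff a ha b hb := by
    rw [mem_remove_carrier] at ha hb
    simp only [FinPoset.remove, Finset.mem_sdiff]
    rw [h.lt_iff a ha.2 b hb.2, h.level_eq hx, h.rank_eq, h.card_levelSet_eq, h.mem_predAt_iff,
      h.mem_predAt_iff]

end IsIsoVia

/-- Two removable elements have nothing above them and, being at the same level, the same
predecessors. -/
theorem IsNested.isIsoVia_swap [DecidableEq α] (hP : P.IsNested) {x y : α} (hx : P.Removable x)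
    (hy : P.Removable y) : IsIsoVia (Equiv.swap x y) P P where
  mem_iff a := by
    rw [Equiv.swap_apply_def]
    split_ifs with h1 h2
    · subst h1
      simp [hx.1.1, hy.1.1]
    · subst h2
      simp [hx.1.1, hy.1.1]
    · rfl
  lt_iff a ha b hb := by
    have hpred := hP.pred_eq hx.1.1 hy.1.1 (hx.2.trans hy.2.symm)
    have hiff : ∀ c ∈ P.carrier, (P.lt c x ↔ P.lt c y) := fun c hc => by
      have : c ∈ P.pred x ↔ c ∈ P.pred y := by rw [hpred]
      simpa [mem_pred, hc] using this
    have hx' := hx.1.2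
    have hy' := hy.1.2
    have hxm := hx.1.1
    have hym := hy.1.1
    rw [Equiv.swap_apply_def x y b]
    by_cases h1 : a = x
    · subst h1
      rw [Equiv.swap_apply_left]
      split_ifs <;> exact iff_of_false (hy' _ ‹_›) (hx' _ hb)
    by_cases h2 : a = y
    · subst h2
      rw [Equiv.swap_apply_right]
      split_ifs <;> exact iff_of_false (hx' _ ‹_›) (hy' _ hb)
    rw [Equiv.swap_apply_of_ne_of_ne h1 h2]
    split_ifs with h3 h4
    · rw [h3]
      exact (hiff a ha).symm
    · rw [h4]
      exact hiff a ha
    · rfl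

theorem Psi_succ_succ (n : ℕ) (P : FinPoset α) (h : ∃ x, P.Removable x) :
    P.Psi (n + 2) = (P.remove h.choose).Psi (n + 1) ++ [P.srank] := by
  rw [Psi, dif_pos h]

theorem Psi_eq_of_isIsoVia {n : ℕ} : ∀ {P Q : FinPoset α} {e : Equiv.Perm α}, IsIsoVia e P Q →
    P.IsNested → P.carrier.card = n → P.Psi n = Q.Psi n := by
  classical
  induction n with
  | zero => intros; rfl
  | succ n ih =>
    intro P Q e h hP hcard
    cases n with
    | zero => rfl
    | succ n =>
      have hexP : ∃ x, P.Removable x := exists_removable (Finset.card_pos.1 (by omega))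
      have hexQ : ∃ x, Q.Removable x := ⟨_, h.removable_iff.2 hexP.choose_spec⟩
      rw [Psi_succ_succ _ _ hexP, Psi_succ_succ _ _ hexQ, h.srank_eq]
      congr 1
      have hx := hexP.choose_spec
      have hy := hexQ.choose_spec
      set x := hexP.choose
      set y := hexQ.choose
      obtain ⟨z, hz⟩ := e.surjective y
      rw [← hz] at hy ⊢
      have hz' := h.removable_iff.1 hy
      -- The isomorphism need not match the two chosen elements; a swap inside `P` corrects this
      -- first.
      have h1 := (hP.isIsoVia_swap hx hz').remove hx.1.1
      rw [Equiv.swap_apply_left] at h1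
      refine ih (h1.trans (h.remove hz'.1.1)) (hP.remove hx.1 (by omega)) ?_
      have := card_remove hx.1.1
      omega

/-- The choice of the removed element does not matter for `Ψ`. -/
theorem IsNested.Psi_eq (hP : P.IsNested) {x : α} (hx : P.Removable x) {n : ℕ} (hn : 1 ≤ n)
    (hcard : P.carrier.card = n + 1) : P.Psi (n + 1) = (P.remove x).Psi n ++ [P.srank] := by
  classical
  obtain ⟨n, rfl⟩ : ∃ k, n = k + 1 := ⟨n - 1, by omega⟩
  rw [Psi_succ_succ _ _ ⟨x, hx⟩]
  congr 1
  have hy := (⟨x, hx⟩ : ∃ x, P.Removable x).choose_spec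
  have h1 := (hP.isIsoVia_swap hy hx).remove hy.1.1
  rw [Equiv.swap_apply_left] at h1
  refine Psi_eq_of_isIsoVia h1 (hP.remove hy.1 (by omega)) ?_
  have := card_remove hy.1.1
  omega

end Iso

end FinPoset

/-! ### Concatenations of blocks with one block added or extended -/

section FlatMap

variable {f g : ℕ → List ℕ} {i n : ℕ}

theorem flatMap_range_succ (f : ℕ → List ℕ) (m : ℕ) :
    (List.range (m + 1)).flatMap f = (List.range m).flatMap f ++ f m := by
  simp [List.range_succ]

theorem flatMap_range_congr (h : ∀ j < i, g j = f j) {m : ℕ} (hm : m ≤ i) :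
    (List.range m).flatMap g = (List.range m).flatMap f := by
  induction m with
  | zero => rfl
  | succ m ih => rw [flatMap_range_succ, flatMap_range_succ, ih (by omega), h m (by omega)]

theorem flatMap_range_insert_block (hlt : ∀ j < i, g j = f j) (hi : g i = [n])
    (hge : ∀ j, i ≤ j → g (j + 1) = f j) {m : ℕ} (hm : i ≤ m) :
    ∃ R, (List.range m).flatMap f = (List.range i).flatMap f ++ R ∧
      (List.range (m + 1)).flatMap g = (List.range i).flatMap f ++ n :: R := by
  induction m, hm using Nat.le_induction with
  | base =>
    refine ⟨[], by simp, ?_⟩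
    rw [flatMap_range_succ, flatMap_range_congr hlt le_rfl, hi]
  | succ m hm ih =>
    obtain ⟨R, h1, h2⟩ := ih
    refine ⟨R ++ f m, ?_, ?_⟩
    · rw [flatMap_range_succ, h1, List.append_assoc]
    · rw [flatMap_range_succ, h2, hge m hm, List.append_assoc, List.cons_append]

theorem flatMap_range_cons_block (hne : ∀ j, j ≠ i → g j = f j) (hi : g i = n :: f i)
    {m : ℕ} (hm : i + 1 ≤ m) :
    ∃ R, (List.range m).flatMap f = (List.range i).flatMap f ++ R ∧
      (List.range m).flatMap g = (List.range i).flatMap f ++ n :: R := by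
  induction m, hm using Nat.le_induction with
  | base =>
    refine ⟨f i, flatMap_range_succ f i, ?_⟩
    rw [flatMap_range_succ, flatMap_range_congr (fun j hj => hne j hj.ne) le_rfl, hi]
  | succ m hm ih =>
    obtain ⟨R, h1, h2⟩ := ih
    refine ⟨R ++ f m, ?_, ?_⟩
    · rw [flatMap_range_succ, h1, List.append_assoc]
    · rw [flatMap_range_succ, h2, hne m (by omega), List.append_assoc, List.cons_append]

end FlatMap

theorem insertIdx_length_append (A B : List ℕ) (n : ℕ) :
    (A ++ B).insertIdx A.length n = A ++ n :: B := by
  rw [insertIdx_eq_take_append_drop (by simp)]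
  simp

/-! ### The word of a poset and its behaviour under removal -/

namespace FinPoset

variable {α : Type*} {P : FinPoset α} {ℓ : α → ℕ} {x : α}

theorem mem_levelWord {j a : ℕ} : a ∈ P.levelWord ℓ j ↔ ∃ y ∈ P.levelSet j, ℓ y = a := by
  classical
  simp [levelWord]

theorem mem_prefixWord {m a : ℕ} :
    a ∈ P.prefixWord ℓ m ↔ ∃ y ∈ P.carrier, P.level y < m ∧ ℓ y = a := by
  simp only [prefixWord, List.mem_flatMap, List.mem_range, mem_levelWord, mem_levelSet]
  constructor
  · rintro ⟨j, hj, y, ⟨hy, rfl⟩, rfl⟩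
    exact ⟨y, hy, hj, rfl⟩
  · rintro ⟨y, hy, hj, rfl⟩
    exact ⟨_, hj, y, ⟨hy, rfl⟩, rfl⟩

theorem levelWord_congr {Q : FinPoset α} {j j' : ℕ} (h : P.levelSet j = Q.levelSet j') :
    P.levelWord ℓ j = Q.levelWord ℓ j' := by
  rw [levelWord, levelWord, h]

theorem IsNested.levelWord_ne_nil (hP : P.IsNested) (hne : P.carrier.Nonempty) {j : ℕ}
    (hj : j ≤ P.rank) : P.levelWord ℓ j ≠ [] := by
  obtain ⟨y, hy, hyl⟩ := (hP.exists_level_iff hne j).2 hj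
  exact List.ne_nil_of_mem (mem_levelWord.2 ⟨y, mem_levelSet.2 ⟨hy, hyl⟩, rfl⟩)

theorem IsNested.length_prefixWord_lt (hP : P.IsNested) (hne : P.carrier.Nonempty) {j k : ℕ}
    (hjk : j < k) (hk : k ≤ P.rank + 1) :
    (P.prefixWord ℓ j).length < (P.prefixWord ℓ k).length := by
  induction k, hjk using Nat.le_induction with
  | base =>
    have := List.length_pos_iff.2 (hP.levelWord_ne_nil (ℓ := ℓ) hne (by omega : j ≤ P.rank))
    rw [prefixWord, prefixWord, flatMap_range_succ, List.length_append]
    omega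
  | succ k hjk ih =>
    refine (ih (by omega)).trans_le ?_
    rw [prefixWord, prefixWord, flatMap_range_succ, List.length_append]
    omega

/-- The word read off the levels is an admissible permutation with value `Ψ P` under `Λ`, and its
active sites are the boundaries between the levels. -/
structure WordSpec (ℓ : α → ℕ) (P : FinPoset α) : Prop where
  le_card : ∀ y ∈ P.carrier, ℓ y ≤ P.carrier.card
  injOn : Set.InjOn ℓ P.carrier
  exists_removable : ∃ x, P.Removable x ∧ ℓ x = P.carrier.card
  mem_permsR : P.word ℓ ∈ permsR P.carrier.card
  Lam_word : Lam P.carrier.card (P.word ℓ) = P.Psi P.carrier.card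
  mem_activeSites : ∀ s, s ∈ activeSites (P.word ℓ) ↔
    ∃ j ≤ P.rank + 1, s = (P.prefixWord ℓ j).length

/-- Every block is nonempty, so the boundaries are strictly increasing and exactly `i` of them
precede boundary `i`. -/
theorem IsNested.siteLabel_word (hP : P.IsNested) (hne : P.carrier.Nonempty)
    (h : ∀ s, s ∈ activeSites (P.word ℓ) ↔ ∃ j ≤ P.rank + 1, s = (P.prefixWord ℓ j).length)
    {i : ℕ} (hi : i ≤ P.rank + 1) :
    siteLabel (P.word ℓ) (P.prefixWord ℓ i).length = i := by
  classical
  have hinj : ∀ j ≤ P.rank + 1, ∀ k ≤ P.rank + 1,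
      (P.prefixWord ℓ j).length < (P.prefixWord ℓ k).length → j < k := by
    intro j hj k hk hlt
    by_contra hcon
    rcases (not_lt.1 hcon).lt_or_eq with h' | rfl
    · exact absurd (hP.length_prefixWord_lt (ℓ := ℓ) hne h' hj) (by omega)
    · omega
  have : (activeSites (P.word ℓ)).filter (fun t => t < (P.prefixWord ℓ i).length)
      = (Finset.range i).image fun j => (P.prefixWord ℓ j).length := by
    ext t
    rw [Finset.mem_filter, h, Finset.mem_image]
    constructor
    · rintro ⟨⟨j, hj, rfl⟩, hlt⟩
      exact ⟨j, Finset.mem_range.2 (hinj j hj i hi hlt), rfl⟩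
    · rintro ⟨j, hj, rfl⟩
      rw [Finset.mem_range] at hj
      exact ⟨⟨j, by omega, rfl⟩, hP.length_prefixWord_lt hne hj hi⟩
  rw [siteLabel, this, Finset.card_image_of_injOn, Finset.card_range]
  intro j hj k hk hjk
  simp only [Finset.coe_range, Set.mem_Iio] at hj hk
  dsimp only at hjk
  rcases lt_trichotomy j k with h' | h' | h'
  · exact absurd hjk (hP.length_prefixWord_lt hne h' (by omega)).ne
  · exact h'
  · exact absurd hjk (hP.length_prefixWord_lt hne h' (by omega)).ne'

theorem levelWord_eq_cons (hx : x ∈ P.carrier) (hxmax : ∀ y ∈ P.carrier, y ≠ x → ℓ y < ℓ x)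
    {Q : FinPoset α}
    (hQ : ∀ y, y ∈ Q.levelSet (P.level x) ↔ y ≠ x ∧ y ∈ P.levelSet (P.level x)) :
    P.levelWord ℓ (P.level x) = ℓ x :: Q.levelWord ℓ (P.level x) := by
  classical
  have hset : P.levelSet (P.level x) = insert x (Q.levelSet (P.level x)) := by
    ext y
    rw [Finset.mem_insert, hQ]
    by_cases hyx : y = x
    · simp [hyx, mem_levelSet, hx]
    · simp [hyx]
  have hlt : ∀ y ∈ Q.levelSet (P.level x), ℓ y < ℓ x := fun y hy => by
    obtain ⟨h1, h2⟩ := (hQ y).1 hy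
    exact hxmax y (mem_levelSet.1 h2).1 h1
  unfold levelWord
  have himg : (P.levelSet (P.level x)).image ℓ = insert (ℓ x) ((Q.levelSet (P.level x)).image ℓ) := by
    rw [hset, Finset.image_insert]
  have key : (insert (ℓ x) ((Q.levelSet (P.level x)).image ℓ)).sort (fun a b => b ≤ a)
      = ℓ x :: ((Q.levelSet (P.level x)).image ℓ).sort (fun a b => b ≤ a) := by
    refine Finset.sort_insert _ ?_ ?_
    · intro b hb
      obtain ⟨y, hy, rfl⟩ := Finset.mem_image.1 hb
      exact (hlt y hy).le
    · intro hb
      obtain ⟨y, hy, hyx⟩ := Finset.mem_image.1 hb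
      exact (hlt y hy).ne hyx
  rw [← key, ← himg]

/-- Reading the word of `P` amounts to inserting the largest label into the word of the poset
obtained by removal, at the boundary before the level of the removed element. -/
theorem IsNested.prefixWord_remove (hP : P.IsNested) (hx : P.IsMaxElt x)
    (hcard : 2 ≤ P.carrier.card) (hxmax : ∀ y ∈ P.carrier, y ≠ x → ℓ y < ℓ x) :
    P.level x ≤ (P.remove x).rank + 1 ∧
    P.word ℓ = ((P.remove x).word ℓ).insertIdx ((P.remove x).prefixWord ℓ (P.level x)).length (ℓ x) ∧
    (∀ j ≤ P.level x, P.prefixWord ℓ j = (P.remove x).prefixWord ℓ j) ∧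
    if (P.levelSet (P.level x)).card = 1 then
      P.rank = (P.remove x).rank + 1 ∧ ∀ j, P.level x ≤ j →
        (P.prefixWord ℓ (j + 1)).length = ((P.remove x).prefixWord ℓ j).length + 1
    else
      P.rank = (P.remove x).rank ∧ P.level x ≤ (P.remove x).rank ∧ ∀ j, P.level x < j →
        (P.prefixWord ℓ j).length = ((P.remove x).prefixWord ℓ j).length + 1 := by
  classical
  have hxr := hP.level_le_rank hx.1
  by_cases hc : (P.levelSet (P.level x)).card = 1
  · obtain ⟨hr, hlev, hQ⟩ := hP.remove_of_card_eq_one hx hcard hc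
    have hne := fun y => level_ne_of_card_eq_one hx.1 hc (y := y)
    have hlt : ∀ j < P.level x, P.levelWord ℓ j = (P.remove x).levelWord ℓ j := by
      intro j hj
      refine levelWord_congr ?_
      ext y
      rw [mem_levelSet, mem_levelSet]
      constructor
      · rintro ⟨hy, rfl⟩
        have hyQ : y ∈ (P.remove x).carrier :=
          mem_remove_carrier.2 ⟨by rintro rfl; omega, hy⟩
        exact ⟨hyQ, by rw [hlev y hyQ, if_pos hj]⟩
      · rintro ⟨hy, rfl⟩
        have h1 := hne y hy
        refine ⟨(mem_remove_carrier.1 hy).2, ?_⟩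
        rw [hlev y hy] at hj ⊢
        split_ifs at hj ⊢ <;> omega
    have hge : ∀ j, P.level x ≤ j → P.levelWord ℓ (j + 1) = (P.remove x).levelWord ℓ j := by
      intro j hj
      refine levelWord_congr ?_
      ext y
      rw [mem_levelSet, mem_levelSet]
      constructor
      · rintro ⟨hy, hyl⟩
        have hyQ : y ∈ (P.remove x).carrier :=
          mem_remove_carrier.2 ⟨by rintro rfl; omega, hy⟩
        exact ⟨hyQ, by rw [hlev y hyQ, if_neg (by omega), hyl, Nat.add_sub_cancel]⟩
      · rintro ⟨hy, rfl⟩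
        have h1 := hne y hy
        refine ⟨(mem_remove_carrier.1 hy).2, ?_⟩
        rw [hlev y hy] at hj ⊢
        split_ifs at hj ⊢ <;> omega
    have hi : P.levelWord ℓ (P.level x) = [ℓ x] := by
      obtain ⟨z, hz⟩ := Finset.card_eq_one.1 hc
      have : x ∈ P.levelSet (P.level x) := mem_levelSet.2 ⟨hx.1, rfl⟩
      rw [hz, Finset.mem_singleton] at this
      subst this
      rw [levelWord, hz]
      simp
    have key := fun m => flatMap_range_insert_block hlt hi hge (m := m)
    refine ⟨by omega, ?_, fun j hj => flatMap_range_congr hlt hj, ?_⟩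
    · obtain ⟨R, h1, h2⟩ := key ((P.remove x).rank + 1) (by omega)
      simp only [word, prefixWord, ← hr, h1, h2]
      rw [insertIdx_length_append]
    · rw [if_pos hc]
      refine ⟨hr.symm, fun j hj => ?_⟩
      obtain ⟨R, h1, h2⟩ := key j hj
      simp only [prefixWord, h1, h2, List.length_append, List.length_cons]
      omega
  · obtain ⟨hr, hlev, hQ⟩ := hP.remove_of_card_ne_one hx hc
    have hset : ∀ j y, y ∈ (P.remove x).levelSet j ↔ y ≠ x ∧ y ∈ P.levelSet j := by
      intro j y
      rw [mem_levelSet, mem_levelSet, ← and_assoc, ← mem_remove_carrier]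
      exact and_congr_right fun hy => by rw [hlev y hy]
    have hne : ∀ j, j ≠ P.level x → P.levelWord ℓ j = (P.remove x).levelWord ℓ j := by
      intro j hj
      refine levelWord_congr ?_
      ext y
      rw [hset]
      refine ⟨fun hy => ⟨?_, hy⟩, And.right⟩
      rintro rfl
      exact hj (mem_levelSet.1 hy).2.symm
    have hi := levelWord_eq_cons hx.1 hxmax (hset (P.level x))
    have key := fun m => flatMap_range_cons_block hne hi (m := m)
    refine ⟨by omega, ?_, fun j hj => flatMap_range_congr (fun j hj => hne j hj.ne) hj, ?_⟩
    · obtain ⟨R, h1, h2⟩ := key (P.rank + 1) (by omega)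
      simp only [word, prefixWord, hr, h1, h2]
      rw [insertIdx_length_append]
    · rw [if_neg hc]
      refine ⟨hr.symm, by omega, fun j hj => ?_⟩
      obtain ⟨R, h1, h2⟩ := key j hj
      simp only [prefixWord, h1, h2, List.length_append, List.length_cons]
      omega

theorem wordSpec_of_eq_singleton (hcar : P.carrier = {x}) (hx : ℓ x = 1) : WordSpec ℓ P := by
  classical
  have hmem : ∀ y, y ∈ P.carrier ↔ y = x := fun y => by rw [hcar, Finset.mem_singleton]
  have hcard : P.carrier.card = 1 := by rw [hcar, Finset.card_singleton]
  have hpred : P.pred x = ∅ := by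
    ext y
    simp only [mem_pred, hmem, Finset.notMem_empty, iff_false, not_and]
    rintro rfl
    exact P.irrefl y
  have hsets : P.predSets = {∅} := by
    rw [predSets, hcar, Finset.image_singleton, hpred]
  have hrank : P.rank = 0 := by rw [rank, hsets, Finset.card_singleton]
  have hlev : P.level x = 0 := by
    rw [level, hsets, hpred]
    simp
  have hset : P.levelSet 0 = {x} := by
    ext y
    rw [mem_levelSet, hmem, Finset.mem_singleton]
    exact ⟨And.left, fun h => ⟨h, h ▸ hlev⟩⟩
  have hword : P.word ℓ = [1] := by
    simp [word, prefixWord, levelWord, hrank, hset, hx]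
  refine ⟨?_, ?_, ?_, ?_, ?_, ?_⟩
  · intro y hy
    rw [(hmem y).1 hy, hx, hcard]
  · intro y hy z hz _
    rw [(hmem y).1 hy, (hmem z).1 hz]
  · obtain ⟨y, hy⟩ := FinPoset.exists_removable (P := P) ⟨x, (hmem x).2 rfl⟩
    obtain rfl := (hmem y).1 hy.1.1
    exact ⟨y, hy, by rw [hx, hcard]⟩
  · rw [hword, hcard, mem_permsR_iff]
    simp [AvoidsR]
  · rw [hword, hcard]
    rfl
  · intro s
    have h0 : (P.prefixWord ℓ 0).length = 0 := rfl
    have h1 : (P.prefixWord ℓ 1).length = 1 := by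
      have : P.prefixWord ℓ 1 = [1] := by rw [← hword, word, hrank]
      rw [this, List.length_singleton]
    rw [hword, activeSites_singleton_one, hrank]
    simp only [Finset.mem_insert, Finset.mem_singleton]
    constructor
    · rintro (rfl | rfl)
      · exact ⟨0, by omega, h0.symm⟩
      · exact ⟨1, by omega, h1.symm⟩
    · rintro ⟨j, hj, rfl⟩
      interval_cases j
      · exact Or.inl h0
      · exact Or.inr h1

/-- The label clauses of the specification locate the largest label of the smaller poset on a
removable element. This decides whether the site after the inserted entry is active. -/
theorem WordSpec.of_remove (hP : P.IsNested) (hx : P.Removable x) (hcard : 2 ≤ P.carrier.card)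
    (hℓ : ℓ x = P.carrier.card) (hQ : WordSpec ℓ (P.remove x)) : WordSpec ℓ P := by
  classical
  have hQn := hP.remove hx.1 hcard
  have hQne := remove_nonempty hx.1.1 hcard
  have hcQ := card_remove hx.1.1
  have hxmax : ∀ y ∈ P.carrier, y ≠ x → ℓ y < ℓ x := fun y hy hyx => by
    have := hQ.le_card y (mem_remove_carrier.2 ⟨hyx, hy⟩)
    omega
  obtain ⟨hi, hword, hpre, hif⟩ := hP.prefixWord_remove hx.1 hcard hxmax
  have hsr := hP.srank_remove_lt_iff hx hcard
  obtain ⟨w, hw, hwl⟩ := hQ.exists_removable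
  have hact := hQ.mem_activeSites
  have hmem := hQ.mem_permsR
  have hLam := hQ.Lam_word
  set m := (P.remove x).carrier.card with hm
  have hm1 : 1 ≤ m := by omega
  rw [← hcQ] at hℓ
  rw [hℓ] at hword
  have hs : ((P.remove x).prefixWord ℓ (P.level x)).length ∈ activeSites ((P.remove x).word ℓ) :=
    (hact _).2 ⟨_, hi, rfl⟩
  have hlab := hQn.siteLabel_word hQne hact hi
  have hlt := fun j k => hQn.length_prefixWord_lt (ℓ := ℓ) hQne (j := j) (k := k)
  -- The meeting point of both sides: `m` labels the removable element `w`, so it stands left of the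
  -- insertion site iff the level of `w` is below that of `x`, which happens iff `x` was alone.
  have htake : m ∈ ((P.remove x).word ℓ).take ((P.remove x).prefixWord ℓ (P.level x)).length ↔
      (P.levelSet (P.level x)).card = 1 := by
    rw [← hsr]
    have : ((P.remove x).word ℓ).take ((P.remove x).prefixWord ℓ (P.level x)).length
        = (P.remove x).prefixWord ℓ (P.level x) := by
      obtain ⟨d, hd⟩ := Nat.exists_eq_add_of_le hi
      rw [word, hd, prefixWord, prefixWord, List.range_add, List.flatMap_append, List.take_left]
    rw [this, mem_prefixWord, ← hx.2, ← hw.2]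
    constructor
    · rintro ⟨y, hy, hyl, hyw⟩
      rw [hQ.injOn hw.1.1 hy (hwl.trans hyw.symm)]
      exact hyl
    · intro h
      exact ⟨w, hw.1.1, h, hwl⟩
  refine ⟨?_, ?_, ⟨x, hx, by omega⟩, ?_, ?_, ?_⟩
  · intro y hy
    by_cases hyx : y = x
    · rw [hyx]
      omega
    · have := hxmax y hy hyx
      omega
  · intro y hy z hz hyz
    by_cases hyx : y = x
    · by_contra hne
      have := hxmax z hz (fun h => hne (hyx.trans h.symm))
      rw [hyx] at hyz
      omega
    · by_cases hzx : z = x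
      · have := hxmax y hy hyx
        rw [hzx] at hyz
        omega
      · exact hQ.injOn (mem_remove_carrier.2 ⟨hyx, hy⟩) (mem_remove_carrier.2 ⟨hzx, hz⟩) hyz
  · rw [hword, ← hcQ]
    exact insert_mem_permsR hmem hs
  · rw [hword, ← hcQ, hP.Psi_eq hx hm1 hcQ.symm, Lam_insertIdx hm1 hmem hs, hLam, hlab, hx.2]
  · intro t
    set s := ((P.remove x).prefixWord ℓ (P.level x)).length with hsdef
    rw [hword]
    -- Sites up to `s` are the boundaries up to the level of `x`. Site `s + 1` is a boundary iff the
    -- new entry is a whole block. Later sites are old boundaries moved by one position, and by one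
    -- index as well if a block was added.
    rcases lt_trichotomy t (s + 1) with ht | rfl | ht
    · rw [mem_activeSites_insert_of_le hmem hs (by omega), hact]
      constructor
      · rintro ⟨j, hj, rfl⟩
        have hji : j ≤ P.level x := by
          by_contra hcon
          have := hlt (P.level x) j (by omega) hj
          omega
        refine ⟨j, ?_, by rw [hpre j hji]⟩
        split_ifs at hif <;> omega
      · rintro ⟨j, hj, rfl⟩
        by_cases hji : j ≤ P.level x
        · exact ⟨j, by omega, by rw [hpre j hji]⟩
        · exfalso
          split_ifs at hif with hc
          · obtain ⟨hr, hlen⟩ := hif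
            obtain ⟨k, rfl⟩ : ∃ k, j = k + 1 := ⟨j - 1, by omega⟩
            rw [hlen k (by omega)] at ht
            rcases (show P.level x ≤ k by omega).eq_or_lt with h | h
            · subst h
              omega
            · have := hlt _ _ h (by omega)
              omega
          · obtain ⟨hr, -, hlen⟩ := hif
            rw [hlen j (by omega)] at ht
            have := hlt (P.level x) j (by omega) (by omega)
            omega
    · rw [mem_activeSites_insert_succ hmem hs hm1, htake]
      constructor
      · intro hc
        rw [if_pos hc] at hif
        exact ⟨P.level x + 1, by omega, by rw [hif.2 _ le_rfl]⟩
      · rintro ⟨j, hj, hjs⟩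
        by_contra hc
        rw [if_neg hc] at hif
        obtain ⟨hr, hir, hlen⟩ := hif
        by_cases hji : j ≤ P.level x
        · rw [hpre j hji] at hjs
          rcases hji.eq_or_lt with h | h
          · subst h
            omega
          · have := hlt _ _ h (by omega)
            omega
        · rw [hlen j (by omega)] at hjs
          have := hlt (P.level x) j (by omega) (by omega)
          omega
    · obtain ⟨t, rfl⟩ : ∃ t', t = t' + 1 := ⟨t - 1, by omega⟩
      rw [mem_activeSites_insert_of_gt hmem hs (by omega), hact]
      have hgt : ∀ j ≤ P.rank + 1, t + 1 = (P.prefixWord ℓ j).length → P.level x < j := by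
        intro j hj hjt
        by_contra hcon
        rw [hpre j (by omega)] at hjt
        rcases (not_lt.1 hcon).eq_or_lt with h | h
        · subst h
          omega
        · have := hlt _ _ h (by omega)
          omega
      have hgt' : ∀ j ≤ (P.remove x).rank + 1, t = ((P.remove x).prefixWord ℓ j).length →
          P.level x < j := by
        intro j hj hjt
        by_contra hcon
        rcases (not_lt.1 hcon).eq_or_lt with h | h
        · subst h
          omega
        · have := hlt _ _ h (by omega)
          omega
      split_ifs at hif with hc
      · obtain ⟨hr, hlen⟩ := hif
        constructor
        · rintro ⟨j, hj, hjt⟩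
          have := hgt' j hj hjt
          exact ⟨j + 1, by omega, by rw [hlen j (by omega), hjt]⟩
        · rintro ⟨j, hj, hjt⟩
          have := hgt j hj hjt
          obtain ⟨k, rfl⟩ : ∃ k, j = k + 1 := ⟨j - 1, by omega⟩
          rw [hlen k (by omega)] at hjt
          exact ⟨k, by omega, by omega⟩
      · obtain ⟨hr, hir, hlen⟩ := hif
        constructor
        · rintro ⟨j, hj, hjt⟩
          have := hgt' j hj hjt
          exact ⟨j, by omega, by rw [hlen j (by omega), hjt]⟩
        · rintro ⟨j, hj, hjt⟩
          have := hgt j hj hjt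
          rw [hlen j (by omega)] at hjt
          exact ⟨j, by omega, by omega⟩

theorem IsCanonicalLabelling.wordSpec (h : P.IsCanonicalLabelling ℓ) (hP : P.IsNested) :
    WordSpec ℓ P := by
  induction h with
  | single P x hcar hx => exact wordSpec_of_eq_singleton hcar hx
  | step P x hcard hrem hx _ ih =>
    exact WordSpec.of_remove hP hrem hcard hx (ih (hP.remove hrem.1 hcard))

theorem IsCanonicalLabelling.congr {ℓ' : α → ℕ} (h : P.IsCanonicalLabelling ℓ)
    (hℓ : ∀ y ∈ P.carrier, ℓ' y = ℓ y) : P.IsCanonicalLabelling ℓ' := by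
  induction h with
  | single P x hcar hx =>
    exact .single P x hcar (by rw [hℓ x (by simp [hcar]), hx])
  | step P x hcard hrem hx _ ih =>
    exact .step P x hcard hrem (by rw [hℓ x hrem.1.1, hx])
      (ih fun y hy => hℓ y (mem_remove_carrier.1 hy).2)

theorem exists_isCanonicalLabelling (n : ℕ) : ∀ P : FinPoset α, P.carrier.card = n + 1 →
    ∃ ℓ : α → ℕ, P.IsCanonicalLabelling ℓ := by
  classical
  induction n with
  | zero =>
    intro P hcard
    obtain ⟨x, hx⟩ := Finset.card_eq_one.1 hcard
    exact ⟨fun _ => 1, .single P x hx rfl⟩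
  | succ n ih =>
    intro P hcard
    obtain ⟨x, hx⟩ := exists_removable (P := P) (Finset.card_pos.1 (by omega))
    obtain ⟨ℓ, hℓ⟩ := ih (P.remove x) (by have := card_remove hx.1.1; omega)
    -- Being canonical depends only on the labels of elements of the poset, so relabelling the
    -- removed `x` does not disturb the rest.
    refine ⟨Function.update ℓ x P.carrier.card, .step P x (by omega) hx (by simp) ?_⟩
    refine hℓ.congr fun y hy => ?_
    rw [Function.update_of_ne (mem_remove_carrier.1 hy).1]

/-- If neither of `D(x)`, `D(y)` contains the other, choose `a < x` with `a` not below `y`, and `b <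
y` with `b` not below `x`. The chains `a < x` and `b < y` then form an induced `2 + 2`. -/
theorem isNested_of {P : Type*} [Fintype P] [PartialOrder P] (hP : IsTwoPlusTwoFree P) :
    (FinPoset.of P).IsNested := by
  intro x _ y _
  by_contra hcon
  obtain ⟨h1, h2⟩ := not_or.1 hcon
  have hmem : ∀ a b : P, a ∈ (FinPoset.of P).pred b ↔ a < b := fun a b => by
    rw [mem_pred, of_carrier]
    simp [FinPoset.of]
  obtain ⟨a, hax, hay⟩ := Finset.not_subset.1 h1
  obtain ⟨b, hby, hbx⟩ := Finset.not_subset.1 h2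
  rw [hmem] at hax hay hby hbx
  have ab : ¬ a ≤ b := fun h => hay (h.trans_lt hby)
  have ba : ¬ b ≤ a := fun h => hbx (h.trans_lt hax)
  have ay : ¬ a ≤ y := fun h => h.lt_or_eq.elim hay fun h => hbx ((h ▸ hby).trans hax)
  have bx : ¬ b ≤ x := fun h => h.lt_or_eq.elim hbx fun h => hay ((h ▸ hax).trans hby)
  have xb : ¬ x ≤ b := fun h => ab (hax.le.trans h)
  have ya : ¬ y ≤ a := fun h => ba (hby.le.trans h)
  have xy : ¬ x ≤ y := fun h => hay (hax.trans_le h)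
  have yx : ¬ y ≤ x := fun h => hbx (hby.trans_le h)
  let f : Fin 2 ⊕ Fin 2 → P := Sum.elim ![a, x] ![b, y]
  refine hP.false (OrderEmbedding.ofMapLEIff f ?_)
  rintro (i | i) (j | j) <;> fin_cases i <;> fin_cases j <;>
    simp [f, ab, ba, ay, bx, xb, ya, xy, yx, hax.le, hby.le, hax.not_ge, hby.not_ge]

end FinPoset

/-! ### The main result -/

theorem proposition4p1 {P : Type*} [Fintype P] [Nonempty P] [PartialOrder P]
    (hP : IsTwoPlusTwoFree P) :
    -- a canonical labelling exists,
    (∃ ℓ : P → ℕ, (FinPoset.of P).IsCanonicalLabelling ℓ) ∧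
    -- and for every canonical labelling:
    ∀ ℓ : P → ℕ, (FinPoset.of P).IsCanonicalLabelling ℓ →
      -- the word is the unique preimage under `Λ` of the ascent sequence `Ψ P`,
      (FinPoset.of P).word ℓ ∈ permsR (Fintype.card P) ∧
      (FinPoset.of P).Psi (Fintype.card P) ∈ ascentSeqs (Fintype.card P) ∧
      (∀ σ ∈ permsR (Fintype.card P),
        Lam (Fintype.card P) σ = (FinPoset.of P).Psi (Fintype.card P) ↔
          σ = (FinPoset.of P).word ℓ) ∧
      -- and its active sites are the two ends and the boundaries between level blocks.
      ∀ s : ℕ, s ∈ activeSites ((FinPoset.of P).word ℓ) ↔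
        s = 0 ∨ s = ((FinPoset.of P).word ℓ).length ∨
        ∃ j, 1 ≤ j ∧ j ≤ (FinPoset.of P).rank ∧
          s = ((FinPoset.of P).prefixWord ℓ j).length := by
  have hne : (FinPoset.of P).carrier.Nonempty := Finset.univ_nonempty
  have hN := FinPoset.isNested_of hP
  have hcard : (FinPoset.of P).carrier.card = Fintype.card P := rfl
  have hpos : 1 ≤ Fintype.card P := Fintype.card_pos
  refine ⟨FinPoset.exists_isCanonicalLabelling (Fintype.card P - 1) _ (by omega),
    fun ℓ hℓ => ?_⟩
  have hspec := hℓ.wordSpec hN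
  have hmem := hspec.mem_permsR
  have hLam := hspec.Lam_word
  rw [hcard] at hmem hLam
  refine ⟨hmem, hLam ▸ Lam_mem_ascentSeqs hpos hmem, fun σ hσ => ?_, fun s => ?_⟩
  · rw [← hLam]
    exact ⟨fun h => Lam_injOn hpos hσ hmem h, fun h => by rw [h]⟩
  · rw [hspec.mem_activeSites]
    constructor
    · rintro ⟨j, hj, rfl⟩
      rcases Nat.eq_zero_or_pos j with rfl | hj0
      · exact Or.inl rfl
      · rcases hj.eq_or_lt with rfl | hj
        -- Boundary `rank + 1` is the end of the word, since the word is by definition the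
        -- concatenation of its first `rank + 1` blocks.
        · exact Or.inr (Or.inl rfl)
        · exact Or.inr (Or.inr ⟨j, hj0, by omega, rfl⟩)
    · rintro (rfl | rfl | ⟨j, -, hj, rfl⟩)
      · exact ⟨0, by omega, rfl⟩
      · exact ⟨_, le_rfl, rfl⟩
      · exact ⟨j, by omega, rfl⟩
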